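/- Let $C\ge 0$, $T>0$, $\nu\ge 0$, and let $D\colon[0,T]\to\mathbb{R}_+$ be nondecreasing and upper semicontinuous with $D(T)>0$. For $y\in[0,D(T)]$ put $\bar\tau(y)=\inf\{t\in[0,T]: D(t)\ge y\}$, and $\tau(y)=\inf\{t\in[0,T]: D(t)>y\}$ if $y<D(T)$, $\tau(D(T))=T$. For a positive integer $S$ (the number of shuttles), consider the problem $\mathrm{P}^{\mathrm{ave}}_{\text{no return}}$ of minimizing $$g^{\mathrm{ave}}(d,y)=\frac1{D(T)}\sum_{j=1}^S\int_{y_{j-1}}^{y_j}\bigl(d_j-\bar\tau(u)\bigr)\,du$$ over all $d_1,\dots,d_S$ and $y_0,\dots,y_S$ such that $y_0=0$, $y_S=D(T)$, $0\le y_j-y_{j-1}\le C$ and $\bar\tau(y_j)+\nu(y_j-y_{j-1})\le d_j$ for $j=1,\dots,S$, and $d_{j-1}\le d_j$ for $j=2,\dots,S$. Denote by $OPT$ its optimal value. Computational model: exact arithmetic and comparisons on real numbers, evaluation of $D(t)$ for $t\in[0,T]$, integration of $D$ between two values, evaluation of $\tau(y)$ and $\bar\tau(y)$, and evaluation of $\sup\{y:\bar\tau(y)+\nu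 y\le a\}$ for $a\ge 0$ take constant time; $C$, $T$, $\nu$ and $D$ (in particular the number $\inf_{[0,T)}D'_+$) are constants of the model. Theorem. Suppose that $D$ admits a right derivative $D'_+(t)$ at every $t\in[0,T)$ and that $\inf_{t\in[0,T)}D'_+(t)>0$. Then there is an algorithm which, for all positive integers $S$ and $M$ such that the problem is feasible, computes in time $O(SM^3)$ a feasible solution $(d,y)$ of $\mathrm{P}^{\mathrm{ave}}_{\text{no return}}$ satisfying $$g^{\mathrm{ave}}(d,y)\le OPT+O\!\left(\frac{S^2}{M}\right).$$ The constants in both $O(\cdot)$ depend only on $C$, $T$, $\nu$ and $D$, not on $S$ or $M$. Moreover, the algorithm can be taken to be one and the same program for all $C,T,\nu,D$, which accesses them only through the operations and the constants $C$, $T$, $\nu$, $\inf_{[0,T)}D'_+$ above. -/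

import Mathlib

namespace Shuttle

noncomputable section

/-- The constants of the problem without return: the capacity `C` of a shuttle, the length `T` of
the period, the loading rate `ν`, and the cumulative demand `D` on `[0, T]` (the values of `D`
outside `[0, T]` play no role), together with the standing assumptions on them. -/
structure Terminal where
  C : ℝ
  T : ℝ
  ν : ℝ
  D : ℝ → ℝ
  C_nonneg : 0 ≤ C
  T_pos : 0 < T
  ν_nonneg : 0 ≤ ν
  D_nonneg : ∀ t ∈ Set.Icc 0 T, 0 ≤ D t
  D_mono : MonotoneOn D (Set.Icc 0 T)
  D_usc : UpperSemicontinuousOn D (Set.Icc 0 T)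
  D_pos : 0 < D T

namespace Terminal

variable (I : Terminal)

/-- The pseudo-inverse `τ`, meant for `y ∈ [0, D T]`: the arrival time of the first user after the
`y` first ones. -/
def tau (y : ℝ) : ℝ :=
  if y < I.D I.T then sInf {t | t ∈ Set.Icc 0 I.T ∧ y < I.D t} else I.T

/-- The pseudo-inverse `τ̄`, meant for `y ∈ [0, D T]`: the arrival time of the last of the `y` first
users. -/
def tauBar (y : ℝ) : ℝ := sInf {t | t ∈ Set.Icc 0 I.T ∧ y ≤ I.D t}

/-- `sup {y : τ̄ y + ν y ≤ a}`, the supremum being over `y ∈ [0, D T]`, where `τ̄` is defined. -/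
def loadSup (a : ℝ) : ℝ := sSup {y | y ∈ Set.Icc 0 (I.D I.T) ∧ I.tauBar y + I.ν * y ≤ a}

/-- The infimum `α` of the right derivatives `D'₊ t` over `t ∈ [0, T)`. -/
def slope : ℝ := sInf ((fun t => derivWithin I.D (Set.Ioi t) t) '' Set.Ico 0 I.T)

/-- Feasible schedules for `S` shuttles when return is not allowed: the `j`-th departure takes place
at time `d j`, and `y j` users have left after it. Only `d 1, …, d S` and `y 0, …, y S` matter. -/
structure Feasible (S : ℕ) (d y : ℕ → ℝ) : Prop where
  capacity : ∀ j ∈ Finset.Icc 1 S, y j - y (j - 1) ≤ I.C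
  load_mono : ∀ j ∈ Finset.Icc 1 S, y (j - 1) ≤ y j
  departure_mono : ∀ j ∈ Finset.Icc 2 S, d (j - 1) ≤ d j
  all_leave : y S = I.D I.T
  loading : ∀ j ∈ Finset.Icc 1 S, I.tauBar (y j) + I.ν * (y j - y (j - 1)) ≤ d j
  start : y 0 = 0

/-- The average waiting time of a schedule for `S` shuttles. -/
def avgWait (S : ℕ) (d y : ℕ → ℝ) : ℝ :=
  1 / I.D I.T * ∑ j ∈ Finset.Icc 1 S, ∫ u in (y (j - 1))..(y j), (d j - I.tauBar u)

/-- The optimal value of the problem of minimizing the average waiting time, without return. -/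
def optAvg (S : ℕ) : ℝ :=
  sInf {v | ∃ d y : ℕ → ℝ, I.Feasible S d y ∧ v = I.avgWait S d y}

end Terminal

/-! ### The computational model

A random access machine with exact real arithmetic, programmed in a small imperative language. The
memory consists of arrays of natural numbers (used for indices and counters) and of arrays of real
numbers; an array is designated by a number that is fixed in the program, and its entries are
accessed through computed indices. A scalar variable is an entry with a fixed index. A program is a
finite piece of syntax. It has access to the terminal only through the constants and the elementary
queries listed in `RExp`. Real numbers cannot be converted to natural numbers. -/

/-- Contents of the memory: `mem.nat a i` and `mem.real a i` are the `i`-th entries of the `a`-th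
array of natural numbers and of the `a`-th array of real numbers. -/
structure Memory where
  nat : ℕ → ℕ → ℕ
  real : ℕ → ℕ → ℝ

/-- Expressions with natural number values (the subtraction is truncated at `0`). -/
inductive NExp where
  | lit (n : ℕ)
  | get (a : ℕ) (i : NExp)
  | add (e f : NExp)
  | sub (e f : NExp)

/-- Expressions with real values. Besides memory accesses and the arithmetic operations, there are
the constants of the computational model (`C`, `T`, `ν` and the constant `inf D'₊` of `D`), and the
queries: evaluation of `D`, integration of `D` between two values, evaluation of `τ` and of `τ̄`,
evaluation of `sup {y : τ̄ y + ν y ≤ a}`. -/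
inductive RExp where
  | ofNat (e : NExp)
  | get (a : ℕ) (i : NExp)
  | add (e f : RExp)
  | sub (e f : RExp)
  | mul (e f : RExp)
  | div (e f : RExp)
  | constC
  | constT
  | constNu
  | constSlope
  | demand (t : RExp)
  | integral (s t : RExp)
  | tau (y : RExp)
  | tauBar (y : RExp)
  | loadSup (a : RExp)

/-- Tests. -/
inductive BExp where
  | leNat (e f : NExp)
  | leReal (e f : RExp)
  | not (b : BExp)
  | and (b c : BExp)

/-- Programs. -/
inductive Prog where
  | skip
  | setNat (a : ℕ) (i : NExp) (e : NExp)
  | setReal (a : ℕ) (i : NExp) (e : RExp)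
  | seq (p q : Prog)
  | ite (b : BExp) (p q : Prog)
  | while (b : BExp) (p : Prog)

/-- Value of an expression. -/
def NExp.eval (m : Memory) : NExp → ℕ
  | lit n => n
  | get a i => m.nat a (i.eval m)
  | add e f => e.eval m + f.eval m
  | sub e f => e.eval m - f.eval m

/-- Time needed to evaluate an expression: each elementary operation takes one unit of time. -/
def NExp.time : NExp → ℕ
  | lit _ => 1
  | get _ i => i.time + 1
  | add e f => e.time + f.time + 1
  | sub e f => e.time + f.time + 1

/-- Value of an expression. A query outside of the domain of the function is answered by `0`. -/
def RExp.eval (I : Terminal) (m : Memory) : RExp → ℝ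
  | ofNat e => (e.eval m : ℝ)
  | get a i => m.real a (i.eval m)
  | add e f => e.eval I m + f.eval I m
  | sub e f => e.eval I m - f.eval I m
  | mul e f => e.eval I m * f.eval I m
  | div e f => e.eval I m / f.eval I m
  | constC => I.C
  | constT => I.T
  | constNu => I.ν
  | constSlope => I.slope
  | demand t => (Set.Icc 0 I.T).indicator I.D (t.eval I m)
  | integral s t => ∫ x in (s.eval I m)..(t.eval I m), (Set.Icc 0 I.T).indicator I.D x
  | tau y => (Set.Icc 0 (I.D I.T)).indicator I.tau (y.eval I m)
  | tauBar y => (Set.Icc 0 (I.D I.T)).indicator I.tauBar (y.eval I m)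
  | loadSup a => (Set.Ici 0).indicator I.loadSup (a.eval I m)

/-- Time needed to evaluate an expression: each elementary operation or query takes one unit of
time. -/
def RExp.time : RExp → ℕ
  | ofNat e => e.time + 1
  | get _ i => i.time + 1
  | add e f => e.time + f.time + 1
  | sub e f => e.time + f.time + 1
  | mul e f => e.time + f.time + 1
  | div e f => e.time + f.time + 1
  | constC => 1
  | constT => 1
  | constNu => 1
  | constSlope => 1
  | demand t => t.time + 1
  | integral s t => s.time + t.time + 1
  | tau y => y.time + 1
  | tauBar y => y.time + 1
  | loadSup a => a.time + 1

/-- Truth of a test. -/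
def BExp.Holds (I : Terminal) (m : Memory) : BExp → Prop
  | leNat e f => e.eval m ≤ f.eval m
  | leReal e f => e.eval I m ≤ f.eval I m
  | not b => ¬ b.Holds I m
  | and b c => b.Holds I m ∧ c.Holds I m

/-- Time needed to evaluate a test. -/
def BExp.time : BExp → ℕ
  | leNat e f => e.time + f.time + 1
  | leReal e f => e.time + f.time + 1
  | not b => b.time + 1
  | and b c => b.time + c.time + 1

/-- Writing `v` at index `i` of the `a`-th array of natural numbers. -/
def Memory.writeNat (m : Memory) (a i v : ℕ) : Memory where
  nat := Function.update m.nat a (Function.update (m.nat a) i v)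
  real := m.real

/-- Writing `v` at index `i` of the `a`-th array of real numbers. -/
def Memory.writeReal (m : Memory) (a i : ℕ) (v : ℝ) : Memory where
  nat := m.nat
  real := Function.update m.real a (Function.update (m.real a) i v)

/-- `Exec I p m k m'`: for the terminal `I`, the program `p` started on the memory `m` stops after
exactly `k` units of time, on the memory `m'`. -/
inductive Exec (I : Terminal) : Prog → Memory → ℕ → Memory → Prop where
  | skip (m : Memory) : Exec I Prog.skip m 1 m
  | setNat (m : Memory) (a : ℕ) (i e : NExp) :
      Exec I (Prog.setNat a i e) m (i.time + e.time + 1) (m.writeNat a (i.eval m) (e.eval m))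
  | setReal (m : Memory) (a : ℕ) (i : NExp) (e : RExp) :
      Exec I (Prog.setReal a i e) m (i.time + e.time + 1) (m.writeReal a (i.eval m) (e.eval I m))
  | seq (p q : Prog) (m m' m'' : Memory) (k l : ℕ) (hp : Exec I p m k m')
      (hq : Exec I q m' l m'') : Exec I (Prog.seq p q) m (k + l + 1) m''
  | ite_true (b : BExp) (p q : Prog) (m m' : Memory) (k : ℕ) (hb : b.Holds I m)
      (hp : Exec I p m k m') : Exec I (Prog.ite b p q) m (b.time + k + 1) m'
  | ite_false (b : BExp) (p q : Prog) (m m' : Memory) (k : ℕ) (hb : ¬ b.Holds I m)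
      (hq : Exec I q m k m') : Exec I (Prog.ite b p q) m (b.time + k + 1) m'
  | while_true (b : BExp) (p : Prog) (m m' m'' : Memory) (k l : ℕ) (hb : b.Holds I m)
      (hp : Exec I p m k m') (hw : Exec I (Prog.while b p) m' l m'') :
      Exec I (Prog.while b p) m (b.time + k + l + 1) m''
  | while_false (b : BExp) (p : Prog) (m : Memory) (hb : ¬ b.Holds I m) :
      Exec I (Prog.while b p) m (b.time + 1) m

/-- The initial memory on the input `(S, M)`: `S` and `M` are the entries `0` and `1` of the `0`-th
array of natural numbers; everything else is zero. -/
def inputMemory (S M : ℕ) : Memory where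
  nat := fun a i => if a = 0 ∧ i = 0 then S else if a = 0 ∧ i = 1 then M else 0
  real := fun _ _ => 0

/-- The departure times output by a computation: the `0`-th array of real numbers. -/
def Memory.outD (m : Memory) : ℕ → ℝ := m.real 0

/-- The cumulative loads output by a computation: the `1`-st array of real numbers. -/
def Memory.outY (m : Memory) : ℕ → ℝ := m.real 1

end

end Shuttle

/-! The algorithm is a dynamic program over a grid of cumulative loads, the multiples of `η = C / M`
cut off at the total demand `D T`, which has `O(M)` points.

*Dropping a constraint.* The departure times could be made part of the state of the dynamic program,
but this is avoided by ignoring the constraint that they are nondecreasing: each shuttle is charged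
as if it left as soon as it is ready, at `load a b = τ̄ b + ν (b - a)` when it takes the users from
`a` to `b`. Up to the total of `τ̄`, which is the same for all schedules, its cost is then
`cost a b = load a b * (b - a)`. The table has one entry per number of remaining shuttles and grid
point, and an entry is computed by going through all the grid points, which gives a running time of
`O(S M ^ 2)`, hence of `O(S M ^ 3)`. At the end each departure is delayed until the previous one has
taken place.

*Lower bound.* Any feasible schedule is rounded up to the grid (`Feasible.sum_cost_grid_le`). As the
capacity is a multiple of `η`, the rounded loads respect it. Since the right derivatives of `D` are
at least `α > 0`, the function `τ̄` is Lipschitz with constant `1 / α` (`tauBar_le_add`), so the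
rounded shuttles are ready at most `(1 / α + ν) η` after the original departures; and more users
leaving with earlier shuttles does not increase the cost, by summation by parts (`sum_mul_sub_le`).
Hence the value found by the dynamic program exceeds the optimum by `O(1 / M)` at most.

*Upper bound.* On the path found by the dynamic program a shuttle is ready at most `ν η` later than
the next one: otherwise it would be cheaper to move one cell of the grid from its load to the load of
the next one (`load_path_le`). So the final delays are at most `S ν η`, and the schedule is within
`O(S / M)` of the optimum (`schedule_of_table`).

*The program.* Loop-free pieces are executed symbolically (`Runs.of_loopFree`) and loops are treated
with invariants (`Runs.loop`). The table is stored row by row in one array; the invariant of its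
computation is that the entries up to the current position are complete (`Filled`). The value of
not serving all users is a finite penalty that exceeds the cost of every admissible path. -/

namespace Shuttle

/-! ### The pseudo-inverse of the cumulative demand -/

namespace Terminal

variable (I : Terminal)

theorem slope_le_derivWithin (hα : 0 < I.slope) {t : ℝ} (ht : t ∈ Set.Ico 0 I.T) :
    I.slope ≤ derivWithin I.D (Set.Ioi t) t := by
  refine csInf_le ?_ (Set.mem_image_of_mem _ ht)
  by_contra h
  exact hα.ne' (Real.sInf_of_not_bddBelow h)

/-- The demand grows at least at the rate `I.slope`. A jump of `D` is upwards, so it does no harm: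
by upper semicontinuity the set of times at which the bound holds is closed, and continuous
induction applies. -/
theorem add_slope_mul_le
    (hD : ∀ t ∈ Set.Ico 0 I.T, DifferentiableWithinAt ℝ I.D (Set.Ioi t) t) (hα : 0 < I.slope)
    {s u : ℝ} (hs : 0 ≤ s) (hsu : s ≤ u) (hu : u ≤ I.T) :
    I.D s + I.slope * (u - s) ≤ I.D u := by
  have key : ∀ c < I.slope, I.D s + c * (u - s) ≤ I.D u := by
    intro c hc
    have hcl : IsClosed ({t | I.D s + c * (t - s) ≤ I.D t} ∩ Set.Icc s u) := by
      have hsub : Set.Icc s u ⊆ Set.Icc 0 I.T := Set.Icc_subset_Icc hs hu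
      have h := (upperSemicontinuousOn_iff_isClosed_hypograph isClosed_Icc).1 (I.D_usc.mono hsub)
      have h2 := h.preimage (f := fun t : ℝ => (t, I.D s + c * (t - s))) (by fun_prop)
      convert h2 using 1
      ext t
      simp only [Set.mem_inter_iff, Set.mem_ofPred_eq, Set.mem_preimage]
      tauto
    refine hcl.Icc_subset_of_forall_exists_gt (by simp) ?_ (Set.right_mem_Icc.2 hsu)
    rintro x ⟨hx, hxs, hxu⟩ y hy
    have hxT : x ∈ Set.Ico 0 I.T := ⟨hs.trans hxs, hxu.trans_le hu⟩
    have hlim := (hasDerivWithinAt_iff_tendsto_slope' Set.self_notMem_Ioi).1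
      (hD x hxT).hasDerivWithinAt
    have hev := hlim.eventually
      (lt_mem_nhds (hc.trans_le (I.slope_le_derivWithin hα hxT)))
    have hev2 : ∀ᶠ t in nhdsWithin x (Set.Ioi x), t ∈ Set.Ioc x y := Ioc_mem_nhdsGT hy
    obtain ⟨t, ht1, ht2⟩ := (hev.and hev2).exists
    refine ⟨t, ?_, ht2⟩
    have hpos : 0 < t - x := sub_pos.2 ht2.1
    rw [slope_def_field, lt_div_iff₀ hpos] at ht1
    simp only [Set.mem_ofPred_eq] at hx ⊢
    linarith
  rcases hsu.eq_or_lt with rfl | hlt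
  · simp
  · by_contra! h
    have hpos : 0 < u - s := sub_pos.2 hlt
    obtain ⟨c, hc1, hc2⟩ := exists_between
      (show (I.D u - I.D s) / (u - s) < I.slope by rw [div_lt_iff₀ hpos]; linarith)
    rw [div_lt_iff₀ hpos] at hc1
    linarith [key c hc2]

theorem tauBar_bddBelow (y : ℝ) : BddBelow {t | t ∈ Set.Icc 0 I.T ∧ y ≤ I.D t} :=
  ⟨0, fun _ h => h.1.1⟩

theorem tauBar_nonneg (y : ℝ) : 0 ≤ I.tauBar y := Real.sInf_nonneg fun _ h => h.1.1

theorem tauBar_le {y : ℝ} (hy : y ≤ I.D I.T) : I.tauBar y ≤ I.T :=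
  csInf_le (I.tauBar_bddBelow y) ⟨⟨I.T_pos.le, le_rfl⟩, hy⟩

theorem tauBar_mono {y z : ℝ} (hyz : y ≤ z) (hz : z ≤ I.D I.T) : I.tauBar y ≤ I.tauBar z :=
  csInf_le_csInf (I.tauBar_bddBelow y) ⟨I.T, ⟨I.T_pos.le, le_rfl⟩, hz⟩
    fun _ h => ⟨h.1, hyz.trans h.2⟩

/-- `τ̄` is Lipschitz, because the demand grows at least at the rate `I.slope`. -/
theorem tauBar_le_add
    (hD : ∀ t ∈ Set.Ico 0 I.T, DifferentiableWithinAt ℝ I.D (Set.Ioi t) t) (hα : 0 < I.slope)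
    {y z : ℝ} (hyz : y ≤ z) (hz : z ≤ I.D I.T) :
    I.tauBar z ≤ I.tauBar y + (z - y) / I.slope := by
  rw [← sub_le_iff_le_add]
  refine le_csInf ⟨I.T, ⟨I.T_pos.le, le_rfl⟩, hyz.trans hz⟩ ?_
  rintro s ⟨⟨hs0, hsT⟩, hs⟩
  rw [sub_le_iff_le_add]
  have hq : 0 ≤ (z - y) / I.slope := div_nonneg (sub_nonneg.2 hyz) hα.le
  rcases le_total (s + (z - y) / I.slope) I.T with h | h
  · refine csInf_le (I.tauBar_bddBelow z) ⟨⟨by linarith, h⟩, ?_⟩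
    have h2 := I.add_slope_mul_le hD hα hs0 (by linarith) h
    rw [add_sub_cancel_left, mul_div_cancel₀ _ hα.ne'] at h2
    linarith
  · exact (I.tauBar_le hz).trans h

theorem tauBar_intervalIntegrable {a b : ℝ} (ha : a ≤ I.D I.T) (hb : b ≤ I.D I.T) :
    IntervalIntegrable I.tauBar MeasureTheory.volume a b := by
  refine MonotoneOn.intervalIntegrable fun y _ z hz hyz => I.tauBar_mono hyz ?_
  exact (Set.mem_uIcc.1 hz).elim (fun h => h.2.trans hb) (fun h => h.2.trans ha)

/-! ### Cost of a schedule -/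

/-- The earliest departure time of a shuttle that takes the users from `a` to `b`. -/
noncomputable def load (a b : ℝ) : ℝ := I.tauBar b + I.ν * (b - a)

/-- The cost of a shuttle that takes the users from `a` to `b` and departs as early as possible, up
to the term `∫ τ̄`, which does not depend on the schedule in total. -/
noncomputable def cost (a b : ℝ) : ℝ := I.load a b * (b - a)

theorem load_nonneg {a b : ℝ} (hab : a ≤ b) : 0 ≤ I.load a b :=
  add_nonneg (I.tauBar_nonneg b) (mul_nonneg I.ν_nonneg (sub_nonneg.2 hab))

theorem cost_nonneg {a b : ℝ} (hab : a ≤ b) : 0 ≤ I.cost a b :=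
  mul_nonneg (I.load_nonneg hab) (sub_nonneg.2 hab)

theorem load_le {a b : ℝ} (hb : b ≤ I.D I.T) (hC : b - a ≤ I.C) :
    I.load a b ≤ I.T + I.ν * I.C :=
  add_le_add (I.tauBar_le hb) (mul_le_mul_of_nonneg_left hC I.ν_nonneg)

variable {I}

theorem Feasible.mono {S : ℕ} {d y : ℕ → ℝ} (h : I.Feasible S d y) {i j : ℕ} (hij : i ≤ j)
    (hj : j ≤ S) : y i ≤ y j := by
  induction j, hij using Nat.le_induction with
  | base => rfl
  | succ j hij ih =>
    exact (ih (by omega)).trans (h.load_mono (j + 1) (Finset.mem_Icc.2 ⟨by omega, hj⟩))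

theorem Feasible.nonneg {S : ℕ} {d y : ℕ → ℝ} (h : I.Feasible S d y) {j : ℕ} (hj : j ≤ S) :
    0 ≤ y j := h.start ▸ h.mono (Nat.zero_le j) hj

theorem Feasible.le_total {S : ℕ} {d y : ℕ → ℝ} (h : I.Feasible S d y) {j : ℕ} (hj : j ≤ S) :
    y j ≤ I.D I.T := h.all_leave ▸ h.mono hj le_rfl

theorem Feasible.pos {S : ℕ} {d y : ℕ → ℝ} (h : I.Feasible S d y) : 0 < S := by
  rcases Nat.eq_zero_or_pos S with rfl | hS
  · exact absurd (h.start.symm.trans h.all_leave) I.D_pos.ne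
  · exact hS

theorem Feasible.capacity_pos {S : ℕ} {d y : ℕ → ℝ} (h : I.Feasible S d y) : 0 < I.C := by
  rcases I.C_nonneg.eq_or_lt with hC | hC
  · exfalso
    have hle : ∀ j ≤ S, y j ≤ 0 := by
      intro j
      induction j with
      | zero => intro _; exact h.start.le
      | succ j ih =>
        intro hj
        have := h.capacity (j + 1) (Finset.mem_Icc.2 ⟨by omega, hj⟩)
        rw [Nat.add_sub_cancel] at this
        linarith [ih (by omega)]
    have := hle S le_rfl
    rw [h.all_leave] at this
    exact I.D_pos.not_ge this
  · exact hC

theorem sum_Icc_one {β : Type*} [AddCommMonoid β] (f : ℕ → β) (S : ℕ) :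
    ∑ j ∈ Finset.Icc 1 S, f j = ∑ j ∈ Finset.range S, f (j + 1) := by
  rw [Finset.range_eq_Ico, Finset.sum_Ico_add' f 0 S 1]
  rfl

/-- The part of the waiting time that depends on the schedule is `∑ d j * (y j - y (j - 1))`. -/
theorem Feasible.avgWait_eq {S : ℕ} {d y : ℕ → ℝ} (h : I.Feasible S d y) :
    I.avgWait S d y = 1 / I.D I.T * (∑ j ∈ Finset.range S, d (j + 1) * (y (j + 1) - y j)
      - ∫ u in (0 : ℝ)..(I.D I.T), I.tauBar u) := by
  have hint : ∀ j < S, IntervalIntegrable I.tauBar MeasureTheory.volume (y j) (y (j + 1)) :=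
    fun j hj => I.tauBar_intervalIntegrable (h.le_total hj.le) (h.le_total hj)
  have htot := intervalIntegral.sum_integral_adjacent_intervals hint
  rw [h.start, h.all_leave] at htot
  rw [avgWait, sum_Icc_one, ← htot, ← Finset.sum_sub_distrib]
  congr 1
  refine Finset.sum_congr rfl fun j hj => ?_
  rw [Nat.add_sub_cancel, intervalIntegral.integral_sub _root_.intervalIntegrable_const
    (hint j (Finset.mem_range.1 hj)), intervalIntegral.integral_const, smul_eq_mul, mul_comm]

/-- Letting users leave with earlier shuttles does not increase the cost of a schedule with
nondecreasing departure times (summation by parts). -/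
theorem sum_mul_sub_le {S : ℕ} {d e : ℕ → ℝ} (hd : ∀ j ∈ Finset.Icc 2 S, d (j - 1) ≤ d j)
    (h0 : e 0 = 0) (hS : e S = 0) (he : ∀ j ≤ S, 0 ≤ e j) :
    ∑ j ∈ Finset.range S, d (j + 1) * (e (j + 1) - e j) ≤ 0 := by
  have key : ∀ n < S, ∑ j ∈ Finset.range (n + 1), d (j + 1) * (e (j + 1) - e j)
      ≤ d (n + 1) * e (n + 1) := by
    intro n
    induction n with
    | zero => simp [h0]
    | succ n ih =>
      intro hn
      rw [Finset.sum_range_succ]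
      have h1 := hd (n + 2) (Finset.mem_Icc.2 ⟨by omega, by omega⟩)
      have h2 := mul_le_mul_of_nonneg_right h1 (he (n + 1) (by omega))
      have h3 := ih (by omega)
      simp only [show n + 2 - 1 = n + 1 by omega, show n + 1 + 1 = n + 2 by omega] at *
      linarith [mul_sub (d (n + 2)) (e (n + 2)) (e (n + 1))]
  cases S with
  | zero => simp
  | succ n => simpa [hS] using key n (by omega)

/-! ### The grid of loads -/

variable (I) in
/-- The grid of cumulative loads: the multiples of `η`, cut off at the total demand. -/
noncomputable def grid (η : ℝ) (k : ℕ) : ℝ := min (k * η) (I.D I.T)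

variable (I) in
/-- The index of the last point of the grid, which is the total demand. -/
noncomputable def gridSize (η : ℝ) : ℕ := ⌈I.D I.T / η⌉₊

theorem grid_le (η : ℝ) (k : ℕ) : I.grid η k ≤ I.D I.T := min_le_right _ _

theorem grid_zero (η : ℝ) : I.grid η 0 = 0 := by simp [grid, I.D_pos.le]

theorem grid_mono {η : ℝ} (hη : 0 < η) : Monotone (I.grid η) := fun _ _ hab =>
  min_le_min_right _ (mul_le_mul_of_nonneg_right (Nat.cast_le.2 hab) hη.le)

theorem grid_nonneg {η : ℝ} (hη : 0 < η) (k : ℕ) : 0 ≤ I.grid η k :=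
  le_min (by positivity) I.D_pos.le

theorem le_gridSize_mul {η : ℝ} (hη : 0 < η) : I.D I.T ≤ I.gridSize η * η :=
  (div_le_iff₀ hη).1 (Nat.le_ceil _)

theorem mul_lt_of_lt_gridSize {η : ℝ} (hη : 0 < η) {k : ℕ} (hk : k < I.gridSize η) :
    k * η < I.D I.T := (lt_div_iff₀ hη).1 (Nat.lt_ceil.1 hk)

theorem grid_eq_of_lt {η : ℝ} (hη : 0 < η) {k : ℕ} (hk : k < I.gridSize η) :
    I.grid η k = k * η := min_eq_left (mul_lt_of_lt_gridSize hη hk).le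

theorem grid_gridSize {η : ℝ} (hη : 0 < η) : I.grid η (I.gridSize η) = I.D I.T :=
  min_eq_right (le_gridSize_mul hη)

theorem grid_lt_succ {η : ℝ} (hη : 0 < η) {k : ℕ} (hk : k < I.gridSize η) :
    I.grid η k < I.grid η (k + 1) := by
  have h := mul_lt_of_lt_gridSize hη hk
  rw [grid_eq_of_lt hη hk]
  refine lt_min ?_ h
  push_cast
  linarith

theorem grid_add_le {η : ℝ} (hη : 0 < η) (k m : ℕ) :
    I.grid η (k + m) ≤ I.grid η k + m * η := by
  have : 0 ≤ m * η := by positivity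
  unfold grid
  rw [← min_add_add_right]
  refine min_le_min ?_ (by linarith)
  push_cast
  linarith

/-- A schedule is rounded up to the grid: each load is replaced by the next grid point. -/
theorem le_grid_ceil {η y : ℝ} (hη : 0 < η) (hy : y ≤ I.D I.T) : y ≤ I.grid η ⌈y / η⌉₊ :=
  le_min ((div_le_iff₀ hη).1 (Nat.le_ceil _)) hy

theorem grid_ceil_le {η y : ℝ} (hη : 0 < η) (hy : 0 ≤ y) : I.grid η ⌈y / η⌉₊ ≤ y + η := by
  refine (min_le_left _ _).trans ?_
  have h := (Nat.ceil_lt_add_one (div_nonneg hy hη.le)).le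
  have h2 := mul_le_mul_of_nonneg_right h hη.le
  rwa [add_mul, div_mul_cancel₀ _ hη.ne', one_mul] at h2

/-- Rounding up to the grid respects the capacity, which is a multiple of the mesh. -/
theorem grid_ceil_sub_le {η y z : ℝ} {M : ℕ} (hη : 0 < η) (hM : M * η = I.C)
    (hyz : z - y ≤ I.C) : I.grid η ⌈z / η⌉₊ - I.grid η ⌈y / η⌉₊ ≤ I.C := by
  have h : ⌈z / η⌉₊ ≤ ⌈y / η⌉₊ + M := by
    refine Nat.ceil_le.2 ?_
    push_cast
    have h1 := Nat.le_ceil (y / η)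
    have h2 : z / η ≤ y / η + M := by
      rw [div_add' _ _ _ hη.ne']
      exact div_le_div_of_nonneg_right (by linarith) hη.le
    linarith
  have := (grid_mono (I := I) hη h).trans (grid_add_le hη _ _)
  linarith

/-- Rounding a feasible schedule up to the grid delays the shuttles by at most
`(1 / α + ν) η`. -/
theorem Feasible.sum_cost_grid_le
    (hD : ∀ t ∈ Set.Ico 0 I.T, DifferentiableWithinAt ℝ I.D (Set.Ioi t) t) (hα : 0 < I.slope)
    {S : ℕ} {d y : ℕ → ℝ} (h : I.Feasible S d y) {η : ℝ} (hη : 0 < η) :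
    ∑ j ∈ Finset.range S, I.cost (I.grid η ⌈y j / η⌉₊) (I.grid η ⌈y (j + 1) / η⌉₊)
      ≤ ∑ j ∈ Finset.range S, d (j + 1) * (y (j + 1) - y j)
        + (1 / I.slope + I.ν) * η * I.D I.T := by
  set r : ℕ → ℝ := fun j => I.grid η ⌈y j / η⌉₊ with hr
  have hr0 : r 0 = 0 := by simp [hr, h.start, grid_zero]
  have hrS : r S = I.D I.T := by simp only [hr, h.all_leave]; exact grid_gridSize hη
  have hyr : ∀ j ≤ S, y j ≤ r j := fun j hj => le_grid_ceil hη (h.le_total hj)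
  have hry : ∀ j ≤ S, r j ≤ y j + η := fun j hj => grid_ceil_le hη (h.nonneg hj)
  have hmono : ∀ j < S, r j ≤ r (j + 1) := fun j hj =>
    grid_mono hη (Nat.ceil_le_ceil (div_le_div_of_nonneg_right (h.mono (Nat.le_succ j) hj) hη.le))
  have hload : ∀ j < S, I.load (r j) (r (j + 1)) ≤ d (j + 1) + (1 / I.slope + I.ν) * η := by
    intro j hj
    have h1 := h.loading (j + 1) (Finset.mem_Icc.2 ⟨by omega, hj⟩)
    rw [Nat.add_sub_cancel] at h1
    have h2 := I.tauBar_le_add hD hα (hyr (j + 1) hj) (grid_le η _)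
    have h3 : (r (j + 1) - y (j + 1)) / I.slope ≤ η / I.slope :=
      div_le_div_of_nonneg_right (by linarith [hry (j + 1) hj]) hα.le
    have h4 : I.ν * (r (j + 1) - r j) ≤ I.ν * (y (j + 1) - y j + η) :=
      mul_le_mul_of_nonneg_left (by linarith [hry (j + 1) hj, hyr j hj.le]) I.ν_nonneg
    have h5 : (1 / I.slope + I.ν) * η = η / I.slope + I.ν * η := by ring
    rw [h5]
    change I.tauBar (r (j + 1)) + I.ν * (r (j + 1) - r j) ≤ _
    linarith
  have habel := sum_mul_sub_le (e := fun j => r j - y j) h.departure_mono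
    (by simp [hr0, h.start]) (by simp [hrS, h.all_leave]) (fun j hj => sub_nonneg.2 (hyr j hj))
  calc ∑ j ∈ Finset.range S, I.cost (r j) (r (j + 1))
      ≤ ∑ j ∈ Finset.range S, (d (j + 1) + (1 / I.slope + I.ν) * η) * (r (j + 1) - r j) :=
        Finset.sum_le_sum fun j hj => mul_le_mul_of_nonneg_right
          (hload j (Finset.mem_range.1 hj)) (sub_nonneg.2 (hmono j (Finset.mem_range.1 hj)))
    _ = ∑ j ∈ Finset.range S, d (j + 1) * (y (j + 1) - y j)
        + ∑ j ∈ Finset.range S, d (j + 1) * ((r (j + 1) - y (j + 1)) - (r j - y j))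
        + (1 / I.slope + I.ν) * η * ∑ j ∈ Finset.range S, (r (j + 1) - r j) := by
      rw [Finset.mul_sum, ← Finset.sum_add_distrib, ← Finset.sum_add_distrib]
      exact Finset.sum_congr rfl fun j _ => by ring
    _ ≤ _ := by
      rw [Finset.sum_range_sub, hr0, hrS, sub_zero]
      linarith

/-! ### The dynamic program -/

variable (I) in
/-- An upper bound for the cost of a sequence of loads that respects the capacity and serves all
users; the dynamic program uses it as the cost of not serving all users. -/
noncomputable def penalty : ℝ := (I.T + I.ν * I.C) * I.D I.T + 1

variable (I) in
/-- One entry of the table of the dynamic program. With `i + 1` shuttles left and the load at the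
grid point `k`, the value `val` is the least cost of a decision `k'` followed by the value for `i`
shuttles, over the `k' ∈ [k, b)` that respect the capacity, and `ch` is the best decision. The entry
for `i` shuttles and grid point `k ≤ K` is at the position `i * (K + 1) + k`. -/
structure Entry (K : ℕ) (g val : ℕ → ℝ) (ch : ℕ → ℕ) (i k b : ℕ) : Prop where
  le_choice : k ≤ ch ((i + 1) * (K + 1) + k)
  choice_le : ch ((i + 1) * (K + 1) + k) ≤ K
  capacity : g (ch ((i + 1) * (K + 1) + k)) - g k ≤ I.C
  val_eq : val ((i + 1) * (K + 1) + k) = I.cost (g k) (g (ch ((i + 1) * (K + 1) + k)))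
    + val (i * (K + 1) + ch ((i + 1) * (K + 1) + k))
  val_le : ∀ k', k ≤ k' → k' < b → g k' - g k ≤ I.C →
    val ((i + 1) * (K + 1) + k) ≤ I.cost (g k) (g k') + val (i * (K + 1) + k')

/-- The grid points visited by following the decisions `ch` with `S` shuttles. -/
def path (K S : ℕ) (ch : ℕ → ℕ) : ℕ → ℕ
  | 0 => 0
  | j + 1 => ch ((S - j) * (K + 1) + path K S ch j)

section Table

variable {K S : ℕ} {g val : ℕ → ℝ} {ch : ℕ → ℕ}

theorem path_le (hT : ∀ i < S, ∀ k ≤ K, I.Entry K g val ch i k (K + 1)) {j : ℕ} (hj : j ≤ S) :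
    path K S ch j ≤ K := by
  induction j with
  | zero => exact Nat.zero_le K
  | succ j ih =>
    have h := (hT (S - j - 1) (by omega) _ (ih (by omega))).choice_le
    rwa [show S - j - 1 + 1 = S - j by omega] at h

theorem entry_path (hT : ∀ i < S, ∀ k ≤ K, I.Entry K g val ch i k (K + 1)) {j : ℕ} (hj : j < S) :
    path K S ch j ≤ path K S ch (j + 1) ∧
    g (path K S ch (j + 1)) - g (path K S ch j) ≤ I.C ∧
    val ((S - j) * (K + 1) + path K S ch j) =
      I.cost (g (path K S ch j)) (g (path K S ch (j + 1)))
        + val ((S - (j + 1)) * (K + 1) + path K S ch (j + 1)) := by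
  have h := hT (S - (j + 1)) (by omega) _ (path_le hT hj.le)
  have e : S - (j + 1) + 1 = S - j := by omega
  have h1 := h.le_choice
  have h2 := h.capacity
  have h3 := h.val_eq
  rw [e] at h1 h2 h3
  exact ⟨h1, h2, h3⟩

theorem val_eq_sum_path (hT : ∀ i < S, ∀ k ≤ K, I.Entry K g val ch i k (K + 1)) {r : ℕ}
    (hr : r ≤ S) : val (S * (K + 1)) =
      ∑ j ∈ Finset.range r, I.cost (g (path K S ch j)) (g (path K S ch (j + 1)))
        + val ((S - r) * (K + 1) + path K S ch r) := by
  induction r with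
  | zero => simp [path]
  | succ r ih => rw [Finset.sum_range_succ, ih (by omega), (entry_path hT hr).2.2, add_assoc]

theorem val_le_sum (hT : ∀ i < S, ∀ k ≤ K, I.Entry K g val ch i k (K + 1)) {q : ℕ → ℕ}
    (h0 : q 0 = 0) (hle : ∀ j ≤ S, q j ≤ K) (hmono : ∀ j < S, q j ≤ q (j + 1))
    (hC : ∀ j < S, g (q (j + 1)) - g (q j) ≤ I.C) {r : ℕ} (hr : r ≤ S) :
    val (S * (K + 1)) ≤ ∑ j ∈ Finset.range r, I.cost (g (q j)) (g (q (j + 1)))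
        + val ((S - r) * (K + 1) + q r) := by
  induction r with
  | zero => simp [h0]
  | succ r ih =>
    have h := (hT (S - (r + 1)) (by omega) _ (hle r (by omega))).val_le (q (r + 1))
      (hmono r hr) (Nat.lt_succ_of_le (hle _ hr)) (hC r hr)
    rw [show S - (r + 1) + 1 = S - r by omega] at h
    rw [Finset.sum_range_succ]
    linarith [ih (by omega)]

/-- The optimal path cannot be improved by changing a single load. -/
theorem cost_add_cost_le (hT : ∀ i < S, ∀ k ≤ K, I.Entry K g val ch i k (K + 1)) {j k : ℕ}
    (hj : j + 1 < S) (h1 : path K S ch j ≤ k) (h2 : k ≤ path K S ch (j + 2))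
    (hC1 : g k - g (path K S ch j) ≤ I.C) (hC2 : g (path K S ch (j + 2)) - g k ≤ I.C) :
    I.cost (g (path K S ch j)) (g (path K S ch (j + 1)))
        + I.cost (g (path K S ch (j + 1))) (g (path K S ch (j + 2)))
      ≤ I.cost (g (path K S ch j)) (g k) + I.cost (g k) (g (path K S ch (j + 2))) := by
  have hK := path_le hT (show j + 2 ≤ S by omega)
  have e1 := (entry_path hT (show j < S by omega)).2.2
  have e2 := (entry_path hT hj).2.2
  have l1 := (hT (S - (j + 1)) (by omega) _ (path_le hT (show j ≤ S by omega))).val_le k h1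
    (by omega) hC1
  have l2 := (hT (S - (j + 2)) (by omega) k (by omega)).val_le _ h2 (Nat.lt_succ_of_le hK) hC2
  rw [show S - (j + 1) + 1 = S - j by omega] at l1
  rw [show S - (j + 2) + 1 = S - (j + 1) by omega] at l2
  rw [show j + 1 + 1 = j + 2 by omega] at e2
  linarith

end Table

section Optimal

variable {η : ℝ} {S : ℕ} {val : ℕ → ℝ} {ch : ℕ → ℕ}

/-- The dynamic program ignores that the departure times have to be nondecreasing, but its solution
almost satisfies this: if a shuttle were ready later than the next one by more than `ν η`, it would
be cheaper to let it leave one cell of the grid to the next one. -/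
theorem load_path_le (hη : 0 < η)
    (hT : ∀ i < S, ∀ k ≤ I.gridSize η,
      I.Entry (I.gridSize η) (I.grid η) val ch i k (I.gridSize η + 1)) {j : ℕ} (hj : j + 1 < S) :
    I.load (I.grid η (path (I.gridSize η) S ch j)) (I.grid η (path (I.gridSize η) S ch (j + 1)))
      ≤ I.load (I.grid η (path (I.gridSize η) S ch (j + 1)))
          (I.grid η (path (I.gridSize η) S ch (j + 2))) + I.ν * η := by
  by_contra! hlt
  obtain ⟨m01, c01, -⟩ := entry_path hT (show j < S by omega)
  obtain ⟨m12, c12, -⟩ := entry_path hT hj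
  have hK1 := path_le hT hj.le
  have hloc := fun k => cost_add_cost_le hT hj (k := k)
  rw [show j + 1 + 1 = j + 2 by omega] at m12 c12
  generalize path (I.gridSize η) S ch j = n0 at *
  generalize path (I.gridSize η) S ch (j + 1) = n1 at *
  generalize path (I.gridSize η) S ch (j + 2) = n2 at *
  have hmono := grid_mono (I := I) hη
  have ht : I.tauBar (I.grid η n1) ≤ I.tauBar (I.grid η n2) :=
    I.tauBar_mono (hmono m12) (grid_le η n2)
  have hν := I.ν_nonneg
  unfold load at hlt
  -- the next shuttle is ready earlier, so its load is smaller, by more than one cell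
  have hgap : I.grid η n2 - I.grid η n1 + η < I.grid η n1 - I.grid η n0 := by
    by_contra! hge
    have := mul_le_mul_of_nonneg_left hge hν
    linarith [mul_add I.ν (I.grid η n2 - I.grid η n1) η]
  have hn : n0 < n1 := by
    rcases m01.eq_or_lt with h | h
    · subst h
      linarith [hmono m12]
    · exact h
  obtain ⟨n, rfl⟩ : ∃ n, n1 = n + 1 := ⟨n1 - 1, by omega⟩
  have hlt1 := grid_lt_succ (I := I) hη (show n < I.gridSize η by omega)
  have hle1 : I.grid η (n + 1) ≤ I.grid η n + η := by simpa using grid_add_le (I := I) hη n 1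
  have hm1 := hmono (show n0 ≤ n by omega)
  have hloc1 := hloc n (by omega) (by omega) (by linarith) (by linarith)
  have ht2 : I.tauBar (I.grid η n) ≤ I.tauBar (I.grid η (n + 1)) :=
    I.tauBar_mono hlt1.le (grid_le η _)
  have h3 := mul_le_mul_of_nonneg_right ht2 (sub_nonneg.2 hm1)
  unfold cost load at hloc1
  set x := I.grid η n0
  set y := I.grid η n
  set z := I.grid η (n + 1)
  set w := I.grid η n2
  set a := I.tauBar z
  set b := I.tauBar w
  -- the change of the cost when the cell `[y, z]` is moved is negative
  have hneg : (z - y) * ((b - a) + 2 * I.ν * ((w - z) - (z - x)) + 2 * I.ν * (z - y)) < 0 := by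
    refine mul_neg_of_pos_of_neg (by linarith) ?_
    have h1 : I.ν * (z - y) ≤ I.ν * η := mul_le_mul_of_nonneg_left (by linarith) hν
    have h2 : I.ν * (w - z) ≤ I.ν * (z - x) - I.ν * η := by
      rw [← mul_sub]
      exact mul_le_mul_of_nonneg_left (by linarith) hν
    linarith
  nlinarith [hneg, h3, hloc1]

theorem sum_cost_path_le (hη : 0 < η) {M : ℕ} (hM : M * η = I.C)
    (hD : ∀ t ∈ Set.Ico 0 I.T, DifferentiableWithinAt ℝ I.D (Set.Ioi t) t) (hα : 0 < I.slope)
    (hT : ∀ i < S, ∀ k ≤ I.gridSize η,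
      I.Entry (I.gridSize η) (I.grid η) val ch i k (I.gridSize η + 1))
    (hval0 : ∀ k < I.gridSize η, val k = I.penalty) (hvalK : val (I.gridSize η) = 0)
    {d y : ℕ → ℝ} (h : I.Feasible S d y) :
    path (I.gridSize η) S ch S = I.gridSize η ∧
    ∑ j ∈ Finset.range S, I.cost (I.grid η (path (I.gridSize η) S ch j))
        (I.grid η (path (I.gridSize η) S ch (j + 1)))
      ≤ ∑ j ∈ Finset.range S, d (j + 1) * (y (j + 1) - y j)
        + (1 / I.slope + I.ν) * η * I.D I.T := by
  have hqK : ⌈y S / η⌉₊ = I.gridSize η := by rw [h.all_leave]; rfl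
  have hmono : ∀ j < S, ⌈y j / η⌉₊ ≤ ⌈y (j + 1) / η⌉₊ := fun j hj =>
    Nat.ceil_le_ceil (div_le_div_of_nonneg_right (h.mono (Nat.le_succ j) hj) hη.le)
  have hle : ∀ j ≤ S, ⌈y j / η⌉₊ ≤ I.gridSize η := fun j hj =>
    Nat.ceil_le_ceil (div_le_div_of_nonneg_right (h.le_total hj) hη.le)
  have hC : ∀ j < S, I.grid η ⌈y (j + 1) / η⌉₊ - I.grid η ⌈y j / η⌉₊ ≤ I.C := fun j hj =>
    grid_ceil_sub_le hη hM (h.capacity (j + 1) (Finset.mem_Icc.2 ⟨by omega, hj⟩))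
  have hup := val_le_sum hT (q := fun j => ⌈y j / η⌉₊) (by simp [h.start]) hle hmono hC le_rfl
  have hpath := val_eq_sum_path hT le_rfl
  simp only [Nat.sub_self, zero_mul, zero_add, hqK, hvalK, add_zero] at hup hpath
  have hgm := grid_mono (I := I) hη
  have hbound : ∑ j ∈ Finset.range S, I.cost (I.grid η ⌈y j / η⌉₊) (I.grid η ⌈y (j + 1) / η⌉₊)
      < I.penalty := by
    have h1 : ∑ j ∈ Finset.range S, I.cost (I.grid η ⌈y j / η⌉₊) (I.grid η ⌈y (j + 1) / η⌉₊)
        ≤ ∑ j ∈ Finset.range S, (I.T + I.ν * I.C)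
          * (I.grid η ⌈y (j + 1) / η⌉₊ - I.grid η ⌈y j / η⌉₊) :=
      Finset.sum_le_sum fun j hj => mul_le_mul_of_nonneg_right
        (I.load_le (grid_le η _) (hC j (Finset.mem_range.1 hj)))
        (sub_nonneg.2 (hgm (hmono j (Finset.mem_range.1 hj))))
    rw [← Finset.mul_sum, Finset.sum_range_sub (fun j => I.grid η ⌈y j / η⌉₊), hqK,
      grid_gridSize hη, h.start, zero_div, Nat.ceil_zero, grid_zero, sub_zero] at h1
    exact h1.trans_lt (lt_add_one _)
  have hnn : 0 ≤ ∑ j ∈ Finset.range S, I.cost (I.grid η (path (I.gridSize η) S ch j))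
      (I.grid η (path (I.gridSize η) S ch (j + 1))) :=
    Finset.sum_nonneg fun j hj => I.cost_nonneg
      (hgm (entry_path hT (Finset.mem_range.1 hj)).1)
  have hend : path (I.gridSize η) S ch S = I.gridSize η := by
    by_contra hne
    have := hval0 _ (lt_of_le_of_ne (path_le hT le_rfl) hne)
    linarith
  refine ⟨hend, ?_⟩
  rw [hend, hvalK, add_zero] at hpath
  rw [← hpath]
  exact hup.trans (h.sum_cost_grid_le hD hα hη)

/-- The schedule read off the table of the dynamic program, with each departure delayed until the
previous ones have taken place, is feasible and near-optimal. -/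
theorem schedule_of_table {M : ℕ} (hMpos : 0 < M) (hη : η = I.C / M)
    (hD : ∀ t ∈ Set.Ico 0 I.T, DifferentiableWithinAt ℝ I.D (Set.Ioi t) t) (hα : 0 < I.slope)
    (hT : ∀ i < S, ∀ k ≤ I.gridSize η,
      I.Entry (I.gridSize η) (I.grid η) val ch i k (I.gridSize η + 1))
    (hval0 : ∀ k < I.gridSize η, val k = I.penalty) (hvalK : val (I.gridSize η) = 0)
    (hfeas : ∃ d y : ℕ → ℝ, I.Feasible S d y) {d' y' : ℕ → ℝ}
    (hy : ∀ j ≤ S, y' j = I.grid η (path (I.gridSize η) S ch j)) (hd0 : d' 0 = 0)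
    (hd : ∀ j < S, d' (j + 1) = max (d' j) (I.load (y' j) (y' (j + 1)))) :
    I.Feasible S d' y' ∧ I.avgWait S d' y'
      ≤ I.optAvg S + (1 / I.slope + 2 * I.ν) * I.C * ((S : ℝ) ^ 2 / (M : ℝ)) := by
  obtain ⟨d₀, y₀, h₀⟩ := hfeas
  have hCpos := h₀.capacity_pos
  have hMR : (0 : ℝ) < M := Nat.cast_pos.2 hMpos
  have hηpos : 0 < η := hη ▸ div_pos hCpos hMR
  have hMη : M * η = I.C := by rw [hη, mul_div_cancel₀ _ hMR.ne']
  have hgm := grid_mono (I := I) hηpos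
  have hstep : ∀ j < S, y' j ≤ y' (j + 1) := by
    intro j hj
    rw [hy j hj.le, hy (j + 1) hj]
    exact hgm (entry_path hT hj).1
  have hy0 : y' 0 = 0 := by rw [hy 0 (Nat.zero_le _)]; exact grid_zero η
  have hyS : y' S = I.D I.T := by
    rw [hy S le_rfl, (sum_cost_path_le hηpos hMη hD hα hT hval0 hvalK h₀).1, grid_gridSize hηpos]
  have hF : I.Feasible S d' y' := by
    constructor
    · intro j hj
      obtain ⟨h1, h2⟩ := Finset.mem_Icc.1 hj
      obtain ⟨i, rfl⟩ : ∃ i, j = i + 1 := ⟨j - 1, by omega⟩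
      rw [Nat.add_sub_cancel, hy i (by omega), hy (i + 1) h2]
      exact (entry_path hT h2).2.1
    · intro j hj
      obtain ⟨h1, h2⟩ := Finset.mem_Icc.1 hj
      obtain ⟨i, rfl⟩ : ∃ i, j = i + 1 := ⟨j - 1, by omega⟩
      exact hstep i h2
    · intro j hj
      obtain ⟨h1, h2⟩ := Finset.mem_Icc.1 hj
      obtain ⟨i, rfl⟩ : ∃ i, j = i + 1 := ⟨j - 1, by omega⟩
      rw [Nat.add_sub_cancel, hd i h2]
      exact le_max_left _ _
    · exact hyS
    · intro j hj
      obtain ⟨h1, h2⟩ := Finset.mem_Icc.1 hj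
      obtain ⟨i, rfl⟩ : ∃ i, j = i + 1 := ⟨j - 1, by omega⟩
      rw [Nat.add_sub_cancel, hd i h2]
      exact le_max_right _ _
    · exact hy0
  refine ⟨hF, ?_⟩
  have hdle : ∀ j < S, d' (j + 1) ≤ I.load (y' j) (y' (j + 1)) + j * (I.ν * η) := by
    intro j
    induction j with
    | zero =>
      intro hj
      rw [hd 0 hj, hd0, max_eq_right (I.load_nonneg (hstep 0 hj))]
      simp
    | succ j ih =>
      intro hj
      have hν : 0 ≤ ((j + 1 : ℕ) : ℝ) * (I.ν * η) := by
        have := I.ν_nonneg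
        positivity
      have h1 := load_path_le hηpos hT hj
      rw [← hy j (by omega), ← hy (j + 1) (by omega), ← hy (j + 2) hj] at h1
      rw [hd (j + 1) hj]
      refine max_le ?_ (by linarith)
      have h2 := ih (by omega)
      push_cast
      rw [show j + 1 + 1 = j + 2 by omega]
      linarith
  have hsum : ∑ j ∈ Finset.range S, d' (j + 1) * (y' (j + 1) - y' j)
      ≤ ∑ j ∈ Finset.range S, I.cost (y' j) (y' (j + 1)) + S * (I.ν * η) * I.D I.T := by
    have h1 : ∀ j ∈ Finset.range S, d' (j + 1) * (y' (j + 1) - y' j)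
        ≤ I.cost (y' j) (y' (j + 1)) + S * (I.ν * η) * (y' (j + 1) - y' j) := by
      intro j hj
      have hjS := Finset.mem_range.1 hj
      rw [cost, ← add_mul]
      refine mul_le_mul_of_nonneg_right ((hdle j hjS).trans ?_) (sub_nonneg.2 (hstep j hjS))
      have h2 : (j : ℝ) ≤ S := Nat.cast_le.2 hjS.le
      have h3 := mul_le_mul_of_nonneg_right h2 (mul_nonneg I.ν_nonneg hηpos.le)
      linarith
    refine (Finset.sum_le_sum h1).trans ?_
    rw [Finset.sum_add_distrib, ← Finset.mul_sum, Finset.sum_range_sub, hy0, hyS, sub_zero]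
  rw [← sub_le_iff_le_add]
  refine le_csInf ⟨_, d₀, y₀, h₀, rfl⟩ ?_
  rintro v ⟨d, y, h, rfl⟩
  rw [sub_le_iff_le_add, hF.avgWait_eq, h.avgWait_eq]
  have hp := (sum_cost_path_le hηpos hMη hD hα hT hval0 hvalK h).2
  have hcong : ∑ j ∈ Finset.range S, I.cost (y' j) (y' (j + 1))
      = ∑ j ∈ Finset.range S, I.cost (I.grid η (path (I.gridSize η) S ch j))
        (I.grid η (path (I.gridSize η) S ch (j + 1))) :=
    Finset.sum_congr rfl fun j hj => by
      have hjS := Finset.mem_range.1 hj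
      rw [hy j hjS.le, hy (j + 1) hjS]
  rw [hcong] at hsum
  have hDpos := I.D_pos
  have hS1 : (1 : ℝ) ≤ S := Nat.one_le_cast.2 h.pos
  have hSS : (S : ℝ) ≤ (S : ℝ) ^ 2 := by nlinarith
  have hrate : (1 / I.slope + I.ν) * η + S * (I.ν * η)
      ≤ (1 / I.slope + 2 * I.ν) * I.C * ((S : ℝ) ^ 2 / (M : ℝ)) := by
    have e : (1 / I.slope + 2 * I.ν) * I.C * ((S : ℝ) ^ 2 / (M : ℝ))
        = (1 / I.slope + I.ν) * η * (S : ℝ) ^ 2 + I.ν * η * (S : ℝ) ^ 2 := by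
      rw [hη]; ring
    have p1 : 0 ≤ (1 / I.slope + I.ν) * η := by
      have := I.ν_nonneg
      positivity
    have p2 : 0 ≤ I.ν * η := mul_nonneg I.ν_nonneg hηpos.le
    rw [e]
    have q1 := mul_le_mul_of_nonneg_left (hS1.trans hSS) p1
    have q2 := mul_le_mul_of_nonneg_left hSS p2
    linarith
  refine le_trans ?_ (add_le_add_right hrate _)
  rw [← sub_nonneg]
  have hfin : (1 / I.D I.T * (∑ j ∈ Finset.range S, d (j + 1) * (y (j + 1) - y j)
        - ∫ u in (0 : ℝ)..(I.D I.T), I.tauBar u) + ((1 / I.slope + I.ν) * η + S * (I.ν * η)))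
      - 1 / I.D I.T * (∑ j ∈ Finset.range S, d' (j + 1) * (y' (j + 1) - y' j)
        - ∫ u in (0 : ℝ)..(I.D I.T), I.tauBar u)
      = 1 / I.D I.T * (∑ j ∈ Finset.range S, d (j + 1) * (y (j + 1) - y j)
        + (1 / I.slope + I.ν) * η * I.D I.T + S * (I.ν * η) * I.D I.T
        - ∑ j ∈ Finset.range S, d' (j + 1) * (y' (j + 1) - y' j)) := by
    field_simp
    ring
  rw [hfin]
  exact mul_nonneg (by positivity) (by linarith)

end Optimal

end Terminal

/-! ### Updating the table -/

namespace Terminal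

variable (I : Terminal) in
/-- The entries of the table of the dynamic program at the positions `K + 1, …, a - 1`, that is, all
of them below `a` except the row of the terminal values, are complete. -/
def Filled (K : ℕ) (g val : ℕ → ℝ) (ch : ℕ → ℕ) (a : ℕ) : Prop :=
  ∀ i k, k ≤ K → (i + 1) * (K + 1) + k < a → I.Entry K g val ch i k (K + 1)

section Table

variable {I : Terminal} {K : ℕ} {g val : ℕ → ℝ} {ch : ℕ → ℕ} {i k b : ℕ}

theorem Filled.update {a : ℕ} (h : I.Filled K g val ch a) (v : ℝ) (c : ℕ) :
    I.Filled K g (Function.update val a v) (Function.update ch a c) a := by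
  intro i k hk ha
  have hE := h i k hk ha
  have hrow : (i + 1) * (K + 1) = i * (K + 1) + (K + 1) := by ring
  have hch : Function.update ch a c ((i + 1) * (K + 1) + k) = ch ((i + 1) * (K + 1) + k) :=
    Function.update_of_ne ha.ne _ _
  have hval : Function.update val a v ((i + 1) * (K + 1) + k) = val ((i + 1) * (K + 1) + k) :=
    Function.update_of_ne ha.ne _ _
  have hprev : ∀ k' ≤ K, Function.update val a v (i * (K + 1) + k') = val (i * (K + 1) + k') :=
    fun k' hk' => Function.update_of_ne (by omega) _ _
  refine ⟨?_, ?_, ?_, ?_, ?_⟩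
  · rw [hch]; exact hE.le_choice
  · rw [hch]; exact hE.choice_le
  · rw [hch]; exact hE.capacity
  · rw [hch, hval, hprev _ hE.choice_le]; exact hE.val_eq
  · intro k' h1 h2 h3
    rw [hval, hprev _ (by omega)]
    exact hE.val_le k' h1 h2 h3

theorem Filled.succ (h : I.Filled K g val ch ((i + 1) * (K + 1) + k)) (hk : k ≤ K)
    (hE : I.Entry K g val ch i k (K + 1)) :
    I.Filled K g val ch ((i + 1) * (K + 1) + k + 1) := by
  intro i' k' hk' ha
  rcases (Nat.lt_succ_iff.1 ha).lt_or_eq with hlt | heq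
  · exact h i' k' hk' hlt
  · have hi : i' = i := by
      have h1 := congrArg (· / (K + 1)) heq
      have e : ∀ a b : ℕ, b ≤ K → ((a + 1) * (K + 1) + b) / (K + 1) = a + 1 := fun a b hb => by
        rw [add_comm, Nat.add_mul_div_right _ _ (Nat.succ_pos K),
          Nat.div_eq_of_lt (Nat.lt_succ_of_le hb), zero_add]
      simp only [e i' k' hk', e i k hk] at h1
      omega
    subst hi
    rwa [show k' = k by omega]

/-- The entry is initialized with the decision to send an empty shuttle. -/
theorem Entry.init (hk : k ≤ K) : I.Entry K g
    (Function.update val ((i + 1) * (K + 1) + k) (val (i * (K + 1) + k)))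
    (Function.update ch ((i + 1) * (K + 1) + k) k) i k k := by
  have hrow : (i + 1) * (K + 1) = i * (K + 1) + (K + 1) := by ring
  have hprev : Function.update val ((i + 1) * (K + 1) + k) (val (i * (K + 1) + k))
      (i * (K + 1) + k) = val (i * (K + 1) + k) := Function.update_of_ne (by omega) _ _
  refine ⟨?_, ?_, ?_, ?_, fun k' h1 h2 => absurd h1 (by omega)⟩
  · rw [Function.update_self]
  · rwa [Function.update_self]
  · rw [Function.update_self, sub_self]; exact I.C_nonneg
  · rw [Function.update_self, Function.update_self, hprev, cost, sub_self, mul_zero, zero_add]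

theorem Entry.replace (h : I.Entry K g val ch i k b) (hb : b ≤ K) (hk : k ≤ b)
    (hC : g b - g k ≤ I.C)
    (hle : I.cost (g k) (g b) + val (i * (K + 1) + b) ≤ val ((i + 1) * (K + 1) + k)) :
    I.Entry K g (Function.update val ((i + 1) * (K + 1) + k)
        (I.cost (g k) (g b) + val (i * (K + 1) + b)))
      (Function.update ch ((i + 1) * (K + 1) + k) b) i k (b + 1) := by
  have hrow : (i + 1) * (K + 1) = i * (K + 1) + (K + 1) := by ring
  have hprev : ∀ v, ∀ k' ≤ K, Function.update val ((i + 1) * (K + 1) + k) v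
      (i * (K + 1) + k') = val (i * (K + 1) + k') :=
    fun v k' hk' => Function.update_of_ne (by omega) _ _
  refine ⟨?_, ?_, ?_, ?_, ?_⟩
  · rwa [Function.update_self]
  · rwa [Function.update_self]
  · rwa [Function.update_self]
  · rw [Function.update_self, Function.update_self, hprev _ _ hb]
  · intro k' h1 h2 h3
    rw [Function.update_self, hprev _ _ (by omega)]
    rcases (Nat.lt_succ_iff.1 h2).lt_or_eq with hlt | rfl
    · exact hle.trans (h.val_le k' h1 hlt h3)
    · exact le_rfl

theorem Entry.keep (h : I.Entry K g val ch i k b)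
    (hle : g b - g k ≤ I.C →
      val ((i + 1) * (K + 1) + k) ≤ I.cost (g k) (g b) + val (i * (K + 1) + b)) :
    I.Entry K g val ch i k (b + 1) := by
  refine ⟨h.le_choice, h.choice_le, h.capacity, h.val_eq, ?_⟩
  intro k' h1 h2 h3
  rcases (Nat.lt_succ_iff.1 h2).lt_or_eq with hlt | rfl
  · exact h.val_le k' h1 hlt h3
  · exact hle h3

end Table

end Terminal

/-! ### Reasoning about programs -/

/-- `Runs I p m t Q`: the program `p`, started on the memory `m`, stops after at most `t` units of
time, on a memory that satisfies `Q`. -/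
def Runs (I : Terminal) (p : Prog) (m : Memory) (t : ℕ) (Q : Memory → Prop) : Prop :=
  ∃ k m', Exec I p m k m' ∧ k ≤ t ∧ Q m'

/-- Programs without loops. -/
def Prog.LoopFree : Prog → Prop
  | skip => True
  | setNat _ _ _ => True
  | setReal _ _ _ => True
  | seq p q => p.LoopFree ∧ q.LoopFree
  | ite _ p q => p.LoopFree ∧ q.LoopFree
  | Prog.while _ _ => False

/-- An upper bound for the running time of a loop-free program. -/
def Prog.cost : Prog → ℕ
  | skip => 1
  | setNat _ i e => i.time + e.time + 1
  | setReal _ i e => i.time + e.time + 1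
  | seq p q => p.cost + q.cost + 1
  | ite b p q => b.time + (p.cost + q.cost) + 1
  | Prog.while _ _ => 0

open Classical in
/-- The memory on which a loop-free program stops. -/
noncomputable def Prog.result (I : Terminal) : Prog → Memory → Memory
  | skip, m => m
  | setNat a i e, m => m.writeNat a (i.eval m) (e.eval m)
  | setReal a i e, m => m.writeReal a (i.eval m) (e.eval I m)
  | seq p q, m => q.result I (p.result I m)
  | ite b p q, m => if b.Holds I m then p.result I m else q.result I m
  | Prog.while _ _, m => m

section Rules

variable {I : Terminal} {m : Memory} {Q R : Memory → Prop} {t t₁ t₂ : ℕ} {p q : Prog}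

theorem Runs.of_loopFree (hp : p.LoopFree) (hQ : Q (p.result I m)) : Runs I p m p.cost Q := by
  suffices h : ∃ k ≤ p.cost, Exec I p m k (p.result I m) by
    obtain ⟨k, hk, he⟩ := h
    exact ⟨k, _, he, hk, hQ⟩
  clear hQ
  induction p generalizing m with
  | skip => exact ⟨1, le_rfl, Exec.skip m⟩
  | setNat a i e => exact ⟨_, le_rfl, Exec.setNat m a i e⟩
  | setReal a i e => exact ⟨_, le_rfl, Exec.setReal m a i e⟩
  | seq p q ihp ihq =>
    obtain ⟨k, hk, hek⟩ := ihp (m := m) hp.1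
    obtain ⟨l, hl, hel⟩ := ihq (m := p.result I m) hp.2
    exact ⟨_, by simp only [Prog.cost]; omega, Exec.seq p q _ _ _ k l hek hel⟩
  | ite b p q ihp ihq =>
    by_cases hb : b.Holds I m
    · obtain ⟨k, hk, hek⟩ := ihp (m := m) hp.1
      have he := Exec.ite_true b p q _ _ k hb hek
      refine ⟨_, ?_, by simpa only [Prog.result, if_pos hb] using he⟩
      simp only [Prog.cost]; omega
    · obtain ⟨k, hk, hek⟩ := ihq (m := m) hp.2
      have he := Exec.ite_false b p q _ _ k hb hek
      refine ⟨_, ?_, by simpa only [Prog.result, if_neg hb] using he⟩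
      simp only [Prog.cost]; omega
  | _ => exact False.elim hp

theorem Runs.seq (hp : Runs I p m t₁ R) (hq : ∀ m', R m' → Runs I q m' t₂ Q) :
    Runs I (Prog.seq p q) m (t₁ + t₂ + 1) Q := by
  obtain ⟨k, m', hk, hkt, hR⟩ := hp
  obtain ⟨l, m'', hl, hlt, hQ⟩ := hq m' hR
  exact ⟨_, m'', Exec.seq p q _ _ _ k l hk hl, by omega, hQ⟩

theorem Runs.mono (hp : Runs I p m t₁ R) (ht : t₁ ≤ t₂) (hRQ : ∀ m', R m' → Q m') :
    Runs I p m t₂ Q := by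
  obtain ⟨k, m', hk, hkt, hR⟩ := hp
  exact ⟨k, m', hk, hkt.trans ht, hRQ m' hR⟩

/-- A loop that is executed `N` times, with the invariant `J`. -/
theorem Runs.loop {b : BExp} {J : ℕ → Memory → Prop} {N c : ℕ} (h0 : J 0 m)
    (hstep : ∀ i < N, ∀ m, J i m → b.Holds I m ∧ Runs I p m c (J (i + 1)))
    (hend : ∀ m, J N m → ¬ b.Holds I m) :
    Runs I (Prog.while b p) m ((N + 1) * (b.time + c + 1)) (J N) := by
  suffices h : ∀ r i m, i + r = N → J i m →
      Runs I (Prog.while b p) m ((r + 1) * (b.time + c + 1)) (J N) from h N 0 m (zero_add N) h0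
  intro r
  induction r with
  | zero =>
    intro i m hi hJ
    rw [add_zero] at hi
    subst hi
    exact ⟨_, m, Exec.while_false b p m (hend m hJ), by omega, hJ⟩
  | succ r ih =>
    intro i m hi hJ
    obtain ⟨hb, k, m', hk, hkt, hJ'⟩ := hstep i (by omega) m hJ
    obtain ⟨l, m'', hl, hlt, hQ⟩ := ih (i + 1) m' (by omega) hJ'
    refine ⟨_, m'', Exec.while_true b p _ _ _ k l hb hk hl, ?_, hQ⟩
    rw [add_mul (r + 1)]
    omega

end Rules

section Memory

variable (m : Memory) (a b i : ℕ)

theorem Memory.writeNat_nat (v : ℕ) : (m.writeNat a i v).nat b =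
    if b = a then Function.update (m.nat a) i v else m.nat b :=
  Function.update_apply m.nat a _ b

theorem Memory.writeReal_real (v : ℝ) : (m.writeReal a i v).real b =
    if b = a then Function.update (m.real a) i v else m.real b :=
  Function.update_apply m.real a _ b

theorem Memory.writeNat_real (v : ℕ) : (m.writeNat a i v).real = m.real := rfl

theorem Memory.writeReal_nat (v : ℝ) : (m.writeReal a i v).nat = m.nat := rfl

end Memory

/-! ### The algorithm -/

namespace Algo

/-- The `i`-th scalar variable with natural number values. The variables `0`, …, `7` are the number
of shuttles, the number `M`, the index of the last grid point, a counter of shuttles, the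
current grid point, the candidate for the next grid point, the position in the table of a row, and
the last grid point of the path. -/
def var (i : ℕ) : NExp := NExp.get 0 (NExp.lit i)

/-- Assignment to the `i`-th scalar variable. -/
def setVar (i : ℕ) (e : NExp) : Prog := Prog.setNat 0 (NExp.lit i) e

/-- The number of grid points, which is the length of a row of the table. -/
def width : NExp := NExp.add (var 2) (NExp.lit 1)

/-- `while e < f do p`. -/
def whileLt (e f : NExp) (p : Prog) : Prog := Prog.while (BExp.not (BExp.leNat f e)) p

/-- `load x y` for two expressions `x` and `y`. -/
def loadExp (x y : RExp) : RExp :=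
  RExp.add (RExp.tauBar y) (RExp.mul RExp.constNu (RExp.sub y x))

/-- `cost x y` for two expressions `x` and `y`. -/
def costExp (x y : RExp) : RExp := RExp.mul (loadExp x y) (RExp.sub y x)

/-- The mesh `C / M`. -/
def meshInit : Prog :=
  Prog.setReal 4 (NExp.lit 0) (RExp.div RExp.constC (RExp.ofNat (var 1)))

/-- One more grid point. -/
def gridBody : Prog :=
  Prog.seq (setVar 2 (NExp.add (var 2) (NExp.lit 1)))
    (Prog.setReal 3 (var 2) (RExp.mul (RExp.ofNat (var 2)) (RExp.get 4 (NExp.lit 0))))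

/-- Computation of the grid points. -/
def gridProg : Prog :=
  Prog.seq meshInit
    (Prog.seq
      (Prog.while (BExp.not (BExp.leReal (RExp.demand RExp.constT) (RExp.get 3 (var 2)))) gridBody)
      (Prog.setReal 3 (var 2) (RExp.demand RExp.constT)))

/-- One more entry of the row of terminal values. -/
def penaltyBody : Prog :=
  Prog.seq
    (Prog.setReal 2 (var 4)
      (RExp.add (RExp.mul (RExp.add RExp.constT (RExp.mul RExp.constNu RExp.constC))
        (RExp.demand RExp.constT)) (RExp.ofNat (NExp.lit 1))))
    (setVar 4 (NExp.add (var 4) (NExp.lit 1)))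

/-- Computation of the row of terminal values. The last one stays `0`. -/
def penaltyProg : Prog := whileLt (var 4) (var 2) penaltyBody

/-- The position of the current entry of the table. -/
def here : NExp := NExp.add (NExp.add (var 6) width) (var 4)

/-- The cost of moving to the candidate, plus the value of the candidate in the previous row. -/
def candidate : RExp :=
  RExp.add (costExp (RExp.get 3 (var 4)) (RExp.get 3 (var 5)))
    (RExp.get 2 (NExp.add (var 6) (var 5)))

/-- Initialization of an entry of the table. -/
def entryInit : Prog :=
  Prog.seq (Prog.setReal 2 here (RExp.get 2 (NExp.add (var 6) (var 4))))
    (Prog.seq (Prog.setNat 1 here (var 4)) (setVar 5 (var 4)))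

/-- Examination of one candidate for an entry of the table. -/
def entryBody : Prog :=
  Prog.seq
    (Prog.ite
      (BExp.and (BExp.leReal (RExp.sub (RExp.get 3 (var 5)) (RExp.get 3 (var 4))) RExp.constC)
        (BExp.leReal candidate (RExp.get 2 here)))
      (Prog.seq (Prog.setReal 2 here candidate) (Prog.setNat 1 here (var 5)))
      Prog.skip)
    (setVar 5 (NExp.add (var 5) (NExp.lit 1)))

/-- Computation of one entry of the table. -/
def entryProg : Prog :=
  Prog.seq entryInit
    (Prog.seq (whileLt (var 5) width entryBody) (setVar 4 (NExp.add (var 4) (NExp.lit 1))))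

/-- Passage to the next row of the table. -/
def rowEnd : Prog :=
  Prog.seq (setVar 6 (NExp.add (var 6) width)) (setVar 3 (NExp.add (var 3) (NExp.lit 1)))

/-- Computation of one row of the table. -/
def rowProg : Prog :=
  Prog.seq (setVar 4 (NExp.lit 0)) (Prog.seq (whileLt (var 4) width entryProg) rowEnd)

/-- Computation of the table. -/
def tableProg : Prog := whileLt (var 3) (var 0) rowProg

/-- The load of one more shuttle, and the time at which it is ready. -/
def shuttleProg : Prog :=
  Prog.seq (setVar 4 (NExp.get 1 (NExp.add (var 6) (var 7))))
    (Prog.seq (setVar 3 (NExp.add (var 3) (NExp.lit 1)))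
    (Prog.seq (Prog.setReal 1 (var 3) (RExp.get 3 (var 4)))
    (Prog.setReal 0 (var 3) (loadExp (RExp.get 3 (var 7)) (RExp.get 3 (var 4))))))

/-- The departure of a shuttle is delayed until the previous one has departed. -/
def delayProg : Prog :=
  Prog.ite (BExp.leReal (RExp.get 0 (var 3)) (RExp.get 0 (NExp.sub (var 3) (NExp.lit 1))))
    (Prog.setReal 0 (var 3) (RExp.get 0 (NExp.sub (var 3) (NExp.lit 1)))) Prog.skip

/-- One more shuttle of the schedule. -/
def outputBody : Prog :=
  Prog.seq shuttleProg
    (Prog.seq delayProg (Prog.seq (setVar 7 (var 4)) (setVar 6 (NExp.sub (var 6) width))))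

/-- Computation of the schedule from the table. -/
def outputProg : Prog :=
  Prog.seq (setVar 3 (NExp.lit 0)) (whileLt (var 3) (var 0) outputBody)

/-- The algorithm. -/
def program : Prog := Prog.seq gridProg (Prog.seq penaltyProg (Prog.seq tableProg outputProg))

/-! ### Correctness and running time -/

/-- The memory before the table is computed: the grid and the row of terminal values are there. -/
structure Ready (I : Terminal) (S K : ℕ) (g : ℕ → ℝ) (m : Memory) : Prop where
  shuttles : m.nat 0 0 = S
  size : m.nat 0 2 = K
  position : m.nat 0 7 = 0
  grid : ∀ k ≤ K, m.real 3 k = g k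
  departure : m.real 0 0 = 0
  load : m.real 1 0 = 0
  terminal : ∀ k < K, m.real 2 k = I.penalty
  terminal_last : m.real 2 K = 0

section

variable {I : Terminal} {S M K : ℕ} {g : ℕ → ℝ}

theorem demand_total : (Set.Icc 0 I.T).indicator I.D I.T = I.D I.T :=
  Set.indicator_of_mem (Set.right_mem_Icc.2 I.T_pos.le) _

theorem loadExp_eval {m : Memory} {x y : RExp} (hy : y.eval I m ∈ Set.Icc 0 (I.D I.T)) :
    (loadExp x y).eval I m = I.load (x.eval I m) (y.eval I m) := by
  simp only [loadExp, RExp.eval, Set.indicator_of_mem hy, Terminal.load]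

theorem costExp_eval {m : Memory} {x y : RExp} (hy : y.eval I m ∈ Set.Icc 0 (I.D I.T)) :
    (costExp x y).eval I m = I.cost (x.eval I m) (y.eval I m) := by
  simp only [costExp, RExp.eval, loadExp_eval hy, Terminal.cost]

theorem whileLt_holds {m : Memory} {e f : NExp} :
    (BExp.not (BExp.leNat f e)).Holds I m ↔ e.eval m < f.eval m := by
  simp [BExp.Holds]

theorem gridProg_runs (hM : 0 < M) (hC : 0 < I.C) : Runs I gridProg (inputMemory S M)
    (meshInit.cost + ((I.gridSize (I.C / M) + 1) *
      ((BExp.not (BExp.leReal (RExp.demand RExp.constT) (RExp.get 3 (var 2)))).time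
        + gridBody.cost + 1)
      + (Prog.setReal 3 (var 2) (RExp.demand RExp.constT)).cost + 1) + 1)
    (fun m => (∀ k ≤ I.gridSize (I.C / M), m.real 3 k = I.grid (I.C / M) k) ∧
      m.real 0 = 0 ∧ m.real 1 = 0 ∧ m.real 2 = 0 ∧ m.nat 0 0 = S ∧
      m.nat 0 2 = I.gridSize (I.C / M) ∧ ∀ v, 3 ≤ v → m.nat 0 v = 0) := by
  have hη : 0 < I.C / M := div_pos hC (Nat.cast_pos.2 hM)
  set η := I.C / M with hηdef
  let J : ℕ → Memory → Prop := fun i m => (∀ k ≤ i, m.real 3 k = k * η) ∧ m.real 4 0 = η ∧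
    m.real 0 = 0 ∧ m.real 1 = 0 ∧ m.real 2 = 0 ∧ m.nat 0 0 = S ∧ m.nat 0 2 = i ∧
    ∀ v, 3 ≤ v → m.nat 0 v = 0
  refine Runs.seq (R := J 0) (Runs.of_loopFree trivial ?_) fun m hm =>
    Runs.seq (Runs.loop (J := J) hm ?_ ?_) fun m hm => Runs.of_loopFree trivial ?_
  · refine ⟨?_, ?_, rfl, rfl, rfl, rfl, rfl, ?_⟩
    · intro k hk
      obtain rfl : k = 0 := by omega
      simp [meshInit, Prog.result, Memory.writeReal_real, inputMemory]
    · simp [meshInit, Prog.result, Memory.writeReal_real, inputMemory, RExp.eval, NExp.eval, var,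
        hηdef]
    · intro v hv
      simp [meshInit, Prog.result, Memory.writeReal_nat, inputMemory, show v ≠ 0 by omega,
        show v ≠ 1 by omega]
  · rintro i hi m ⟨hg, h4, h0, h1, h2, hS, hK, hv⟩
    refine ⟨?_, Runs.of_loopFree ⟨trivial, trivial⟩ ?_⟩
    · have := Terminal.mul_lt_of_lt_gridSize hη hi
      simp only [BExp.Holds, RExp.eval, var, NExp.eval, hK, hg i le_rfl, demand_total, not_le]
      exact this
    · refine ⟨?_, ?_, ?_, ?_, ?_, ?_, ?_, ?_⟩
      · intro k hk
        rcases hk.lt_or_eq with hlt | rfl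
        · have hne : k ≠ i + 1 := hlt.ne
          simp [gridBody, Prog.result, setVar, var, Memory.writeReal_real, Memory.writeNat_real,
            Memory.writeNat_nat, NExp.eval, hK, hne, hg k (by omega)]
        · simp [gridBody, Prog.result, setVar, var, Memory.writeReal_real, Memory.writeNat_real,
            Memory.writeNat_nat, NExp.eval, RExp.eval, hK, h4]
      · simp [gridBody, Prog.result, setVar, Memory.writeReal_real, Memory.writeNat_real, h4]
      · simp [gridBody, Prog.result, setVar, Memory.writeReal_real, Memory.writeNat_real, h0]
      · simp [gridBody, Prog.result, setVar, Memory.writeReal_real, Memory.writeNat_real, h1]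
      · simp [gridBody, Prog.result, setVar, Memory.writeReal_real, Memory.writeNat_real, h2]
      · simp [gridBody, Prog.result, setVar, Memory.writeReal_nat, Memory.writeNat_nat, NExp.eval,
          hS]
      · simp [gridBody, Prog.result, setVar, Memory.writeReal_nat, Memory.writeNat_nat, NExp.eval,
          var, hK]
      · intro v hv3
        have hne : v ≠ 2 := by omega
        simp [gridBody, Prog.result, setVar, Memory.writeReal_nat, Memory.writeNat_nat, NExp.eval,
          hne, hv v hv3]
  · rintro m ⟨hg, -, -, -, -, -, hK, -⟩
    have := Terminal.le_gridSize_mul (I := I) hη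
    simp only [BExp.Holds, RExp.eval, var, NExp.eval, hK, hg _ le_rfl, demand_total, not_not]
    exact this
  · obtain ⟨hg, -, h0, h1, h2, hS, hK, hv⟩ := hm
    refine ⟨?_, ?_, ?_, ?_, hS, hK, hv⟩
    · intro k hk
      rcases hk.lt_or_eq with hlt | rfl
      · have hne : k ≠ I.gridSize η := hlt.ne
        simp [Prog.result, var, Memory.writeReal_real, NExp.eval, hK, hne,
          hg k hk, Terminal.grid_eq_of_lt hη hlt]
      · simp [Prog.result, var, Memory.writeReal_real, NExp.eval, RExp.eval, hK, demand_total,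
          Terminal.grid_gridSize hη]
    · simp [Prog.result, Memory.writeReal_real, h0]
    · simp [Prog.result, Memory.writeReal_real, h1]
    · simp [Prog.result, Memory.writeReal_real, h2]

theorem penaltyProg_runs {m : Memory} (hg : ∀ k ≤ K, m.real 3 k = g k)
    (h0 : m.real 0 = 0) (h1 : m.real 1 = 0) (h2 : m.real 2 = 0) (hS : m.nat 0 0 = S)
    (hK : m.nat 0 2 = K) (hv : ∀ v, 3 ≤ v → m.nat 0 v = 0) :
    Runs I penaltyProg m
      ((K + 1) * ((BExp.not (BExp.leNat (var 2) (var 4))).time + penaltyBody.cost + 1))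
      (fun m => Ready I S K g m ∧ m.nat 0 3 = 0 ∧ m.nat 0 6 = 0) := by
  let J : ℕ → Memory → Prop := fun i m => (∀ k ≤ K, m.real 3 k = g k) ∧ m.real 0 = 0 ∧
    m.real 1 = 0 ∧ (∀ k, m.real 2 k = if k < i then I.penalty else 0) ∧ m.nat 0 0 = S ∧
    m.nat 0 2 = K ∧ m.nat 0 3 = 0 ∧ m.nat 0 4 = i ∧ m.nat 0 6 = 0 ∧ m.nat 0 7 = 0
  refine Runs.mono (Runs.loop (J := J) (N := K) (c := penaltyBody.cost) ?_ ?_ ?_) le_rfl ?_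
  · exact ⟨hg, h0, h1, by simp [h2], hS, hK, hv 3 (by omega), hv 4 (by omega), hv 6 (by omega),
      hv 7 (by omega)⟩
  · rintro i hi m ⟨hg, h0, h1, h2, hS, hK, h3, h4, h6, h7⟩
    refine ⟨?_, Runs.of_loopFree ⟨trivial, trivial⟩ ⟨?_, ?_, ?_, ?_, ?_, ?_, ?_, ?_, ?_, ?_⟩⟩
    · rw [whileLt_holds]
      simpa [var, NExp.eval, h4, hK] using hi
    · simpa [penaltyBody, Prog.result, setVar, Memory.writeReal_real, Memory.writeNat_real] using hg
    · simp [penaltyBody, Prog.result, setVar, Memory.writeReal_real, Memory.writeNat_real, h0]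
    · simp [penaltyBody, Prog.result, setVar, Memory.writeReal_real, Memory.writeNat_real, h1]
    · intro k
      have hpen : ((RExp.add (RExp.mul (RExp.add RExp.constT (RExp.mul RExp.constNu RExp.constC))
          (RExp.demand RExp.constT)) (RExp.ofNat (NExp.lit 1)))).eval I m = I.penalty := by
        simp [RExp.eval, NExp.eval, demand_total, Terminal.penalty]
      simp only [penaltyBody, Prog.result, setVar, Memory.writeReal_real, Memory.writeNat_real,
        hpen, var, NExp.eval, h4, if_true, Function.update_apply, h2]
      split_ifs <;> first | rfl | omega
    all_goals
      simp [penaltyBody, Prog.result, setVar, var, Memory.writeReal_nat, Memory.writeNat_nat,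
        NExp.eval, *]
  · rintro m ⟨-, -, -, -, -, hK, -, h4, -, -⟩
    rw [whileLt_holds]
    simp [var, NExp.eval, h4, hK]
  · rintro m ⟨hg, h0, h1, h2, hS, hK, h3, -, h6, h7⟩
    exact ⟨⟨hS, hK, h7, hg, by simp [h0], by simp [h1], fun k hk => by simp [h2, hk],
      by simp [h2]⟩, h3, h6⟩

theorem setVar_result {m : Memory} (v : ℕ) (e : NExp) :
    (setVar v e).result I m = m.writeNat 0 v (e.eval m) := rfl

theorem Ready.writeVar {m : Memory} (h : Ready I S K g m) {v : ℕ} (c : ℕ) (h0 : v ≠ 0)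
    (h2 : v ≠ 2) (h7 : v ≠ 7) : Ready I S K g (m.writeNat 0 v c) where
  shuttles := by simp [Memory.writeNat_nat, h0.symm, h.shuttles]
  size := by simp [Memory.writeNat_nat, h2.symm, h.size]
  position := by simp [Memory.writeNat_nat, h7.symm, h.position]
  grid := h.grid
  departure := h.departure
  load := h.load
  terminal := h.terminal
  terminal_last := h.terminal_last

theorem Ready.writeChoice {m : Memory} (h : Ready I S K g m) (p c : ℕ) :
    Ready I S K g (m.writeNat 1 p c) where
  shuttles := by simp [Memory.writeNat_nat, h.shuttles]
  size := by simp [Memory.writeNat_nat, h.size]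
  position := by simp [Memory.writeNat_nat, h.position]
  grid := h.grid
  departure := h.departure
  load := h.load
  terminal := h.terminal
  terminal_last := h.terminal_last

theorem Ready.writeValue {m : Memory} (h : Ready I S K g m) {p : ℕ} (hp : K < p) (x : ℝ) :
    Ready I S K g (m.writeReal 2 p x) where
  shuttles := h.shuttles
  size := h.size
  position := h.position
  grid := by simpa [Memory.writeReal_real] using h.grid
  departure := by simp [Memory.writeReal_real, h.departure]
  load := by simp [Memory.writeReal_real, h.load]
  terminal k hk := by
    simp [Memory.writeReal_real, show k ≠ p by omega, h.terminal k hk]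
  terminal_last := by simp [Memory.writeReal_real, hp.ne, h.terminal_last]

/-- The memory during the computation of the row `i + 1` of the table: the entries before the one
for the grid point `k` are complete. -/
structure RowState (I : Terminal) (S K : ℕ) (g : ℕ → ℝ) (i k : ℕ) (m : Memory) : Prop where
  ready : Ready I S K g m
  row : m.nat 0 3 = i
  point : m.nat 0 4 = k
  base : m.nat 0 6 = i * (K + 1)
  filled : I.Filled K g (m.real 2) (m.nat 1) ((i + 1) * (K + 1) + k)

/-- The memory during the computation of the entry for the grid point `k` in the row `i + 1` of the
table: the candidates before `k'` have been examined. -/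
structure EntryState (I : Terminal) (S K : ℕ) (g : ℕ → ℝ) (i k k' : ℕ) (m : Memory) : Prop
    extends RowState I S K g i k m where
  next : m.nat 0 5 = k'
  entry : I.Entry K g (m.real 2) (m.nat 1) i k k'

theorem width_eval {m : Memory} (h : Ready I S K g m) : width.eval m = K + 1 := by
  simp [width, var, NExp.eval, h.size]

theorem here_eval {i k : ℕ} {m : Memory} (h : RowState I S K g i k m) :
    here.eval m = (i + 1) * (K + 1) + k := by
  have : here.eval m = m.nat 0 6 + width.eval m + m.nat 0 4 := rfl
  rw [this, width_eval h.ready, h.base, h.point]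
  ring

theorem candidate_eval {i k k' : ℕ} {m : Memory} (h : EntryState I S K g i k k' m)
    (hg : ∀ k ≤ K, g k ∈ Set.Icc 0 (I.D I.T)) (hk : k ≤ K) (hk' : k' ≤ K) :
    candidate.eval I m = I.cost (g k) (g k') + m.real 2 (i * (K + 1) + k') := by
  have e1 : (RExp.get 3 (var 4)).eval I m = g k := by
    simp [RExp.eval, var, NExp.eval, h.point, h.ready.grid k hk]
  have e2 : (RExp.get 3 (var 5)).eval I m = g k' := by
    simp [RExp.eval, var, NExp.eval, h.next, h.ready.grid k' hk']
  have e3 : (RExp.get 2 (NExp.add (var 6) (var 5))).eval I m = m.real 2 (i * (K + 1) + k') := by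
    simp [RExp.eval, var, NExp.eval, h.base, h.next]
  rw [candidate, RExp.eval, costExp_eval (by rw [e2]; exact hg k' hk'), e1, e2, e3]

theorem EntryState.setNext {i k b b' : ℕ} {m : Memory} (h : RowState I S K g i k m)
    (hE : I.Entry K g (m.real 2) (m.nat 1) i k b) (hb : b' = b) :
    EntryState I S K g i k b (m.writeNat 0 5 b') where
  ready := h.ready.writeVar _ (by decide) (by decide) (by decide)
  row := by simp [Memory.writeNat_nat, h.row]
  point := by simp [Memory.writeNat_nat, h.point]
  base := by simp [Memory.writeNat_nat, h.base]
  filled := by simpa [Memory.writeNat_nat, Memory.writeNat_real] using h.filled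
  next := by simp [Memory.writeNat_nat, hb]
  entry := by simpa [Memory.writeNat_nat, Memory.writeNat_real] using hE

theorem RowState.writeEntry {i k : ℕ} {m : Memory} (h : RowState I S K g i k m) (x : ℝ) (c : ℕ) :
    RowState I S K g i k ((m.writeReal 2 ((i + 1) * (K + 1) + k) x).writeNat 1
      ((i + 1) * (K + 1) + k) c) where
  ready := (h.ready.writeValue (by rw [add_mul]; omega) x).writeChoice _ _
  row := by simp [Memory.writeNat_nat, Memory.writeReal_nat, h.row]
  point := by simp [Memory.writeNat_nat, Memory.writeReal_nat, h.point]
  base := by simp [Memory.writeNat_nat, Memory.writeReal_nat, h.base]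
  filled := by
    simpa [Memory.writeNat_nat, Memory.writeReal_nat, Memory.writeNat_real,
      Memory.writeReal_real] using h.filled.update x c

theorem entryBody_runs {i k k' : ℕ} {m : Memory} (h : EntryState I S K g i k k' m)
    (hg : ∀ k ≤ K, g k ∈ Set.Icc 0 (I.D I.T)) (hk : k ≤ k') (hk' : k' ≤ K) :
    Runs I entryBody m entryBody.cost (EntryState I S K g i k (k' + 1)) := by
  refine Runs.of_loopFree ⟨⟨⟨trivial, trivial⟩, trivial⟩, trivial⟩ ?_
  have hc := candidate_eval h hg (hk.trans hk') hk'
  have hh := here_eval h.toRowState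
  have htest : (BExp.and
      (BExp.leReal (RExp.sub (RExp.get 3 (var 5)) (RExp.get 3 (var 4))) RExp.constC)
      (BExp.leReal candidate (RExp.get 2 here))).Holds I m ↔ g k' - g k ≤ I.C ∧
      I.cost (g k) (g k') + m.real 2 (i * (K + 1) + k') ≤ m.real 2 ((i + 1) * (K + 1) + k) := by
    simp only [BExp.Holds, RExp.eval, hc, hh]
    simp [var, NExp.eval, h.next, h.point, h.ready.grid k' hk', h.ready.grid k (hk.trans hk')]
  simp only [entryBody, Prog.result, setVar_result, htest]
  split_ifs with hb
  · have hh2 : here.eval (m.writeReal 2 ((i + 1) * (K + 1) + k)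
        (I.cost (g k) (g k') + m.real 2 (i * (K + 1) + k'))) = (i + 1) * (K + 1) + k := hh
    have h5 : (var 5).eval (m.writeReal 2 ((i + 1) * (K + 1) + k)
        (I.cost (g k) (g k') + m.real 2 (i * (K + 1) + k'))) = k' := h.next
    rw [hc, hh, hh2, h5]
    refine EntryState.setNext (h.toRowState.writeEntry _ _) ?_ ?_
    · simpa [Memory.writeNat_nat, Memory.writeReal_nat, Memory.writeNat_real,
        Memory.writeReal_real] using h.entry.replace hk' hk hb.1 hb.2
    · simp [var, NExp.eval, Memory.writeNat_nat, Memory.writeReal_nat, h.next]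
  · refine EntryState.setNext h.toRowState (h.entry.keep fun hC => ?_) ?_
    · by_contra! hlt
      exact hb ⟨hC, hlt.le⟩
    · simp [var, NExp.eval, h.next]

theorem entryInit_runs {i k : ℕ} {m : Memory} (h : RowState I S K g i k m) (hk : k ≤ K) :
    Runs I entryInit m entryInit.cost (EntryState I S K g i k k) := by
  refine Runs.of_loopFree ⟨trivial, trivial, trivial⟩ ?_
  have hh := here_eval h
  simp only [entryInit, Prog.result, setVar_result]
  have hv : (RExp.get 2 (NExp.add (var 6) (var 4))).eval I m = m.real 2 (i * (K + 1) + k) := by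
    simp [RExp.eval, var, NExp.eval, h.base, h.point]
  have hh2 : here.eval (m.writeReal 2 ((i + 1) * (K + 1) + k) (m.real 2 (i * (K + 1) + k)))
      = (i + 1) * (K + 1) + k := hh
  have h4 : (var 4).eval (m.writeReal 2 ((i + 1) * (K + 1) + k) (m.real 2 (i * (K + 1) + k)))
      = k := h.point
  rw [hh, hv, hh2, h4]
  refine EntryState.setNext (h.writeEntry _ _) ?_ ?_
  · simpa [Memory.writeNat_nat, Memory.writeReal_nat, Memory.writeNat_real,
      Memory.writeReal_real] using Terminal.Entry.init hk
  · simp [var, NExp.eval, Memory.writeNat_nat, Memory.writeReal_nat, h.point]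

/-- The time for one entry of the table is at most `entryTime` times the number of grid points. -/
def entryTime : ℕ :=
  entryInit.cost + 2 * ((BExp.not (BExp.leNat width (var 5))).time + entryBody.cost + 1)
    + (setVar 4 (NExp.add (var 4) (NExp.lit 1))).cost + 2

theorem entryProg_runs {i k : ℕ} {m : Memory} (h : RowState I S K g i k m)
    (hg : ∀ k ≤ K, g k ∈ Set.Icc 0 (I.D I.T)) (hk : k ≤ K) :
    Runs I entryProg m (entryTime * (K + 1)) (RowState I S K g i (k + 1)) := by
  refine Runs.mono (Runs.seq (entryInit_runs h hk) fun m hm =>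
    Runs.seq (Runs.loop (J := fun r => EntryState I S K g i k (k + r)) (N := K + 1 - k)
      (c := entryBody.cost) hm ?_ ?_) fun m hm => Runs.of_loopFree (Q := RowState I S K g i (k + 1)) trivial ?_) ?_ fun _ => id
  · intro r hr m hm
    refine ⟨?_, entryBody_runs (k' := k + r) hm hg (by omega) (by omega)⟩
    rw [whileLt_holds, width_eval hm.ready]
    simp only [var, NExp.eval, hm.next]
    omega
  · intro m hm
    rw [whileLt_holds, width_eval hm.ready]
    simp only [var, NExp.eval, hm.next]
    omega
  · simp only [setVar_result]
    rw [show k + (K + 1 - k) = K + 1 by omega] at hm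
    exact {
      ready := hm.ready.writeVar _ (by decide) (by decide) (by decide)
      row := by simp [NExp.eval, Memory.writeNat_nat, hm.row]
      point := by simp [NExp.eval, var, Memory.writeNat_nat, hm.point]
      base := by simp [NExp.eval, Memory.writeNat_nat, hm.base]
      filled := by
        have hs := hm.filled.succ hk hm.entry
        rw [add_assoc _ k 1] at hs
        simpa [Memory.writeNat_nat, Memory.writeNat_real] using hs }
  · unfold entryTime
    generalize (BExp.not (BExp.leNat width (var 5))).time + entryBody.cost + 1 = t
    generalize entryInit.cost = a
    generalize (setVar 4 (NExp.add (var 4) (NExp.lit 1))).cost = b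
    have h1 : (K + 1 - k + 1) * t ≤ (2 * (K + 1)) * t := Nat.mul_le_mul_right _ (by omega)
    have h2 : 1 ≤ K + 1 := by omega
    nlinarith [Nat.mul_le_mul_left a h2, Nat.mul_le_mul_left b h2]

/-- The time for one row of the table is at most `rowTime` times the square of the number of grid
points. -/
def rowTime : ℕ :=
  (setVar 4 (NExp.lit 0)).cost + 2 * ((BExp.not (BExp.leNat width (var 4))).time + entryTime + 1)
    + rowEnd.cost + 2

/-- The memory between the computation of the rows `i` and `i + 1` of the table. -/
structure TableState (I : Terminal) (S K : ℕ) (g : ℕ → ℝ) (i : ℕ) (m : Memory) : Prop where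
  ready : Ready I S K g m
  row : m.nat 0 3 = i
  base : m.nat 0 6 = i * (K + 1)
  filled : I.Filled K g (m.real 2) (m.nat 1) ((i + 1) * (K + 1))

theorem rowProg_runs {i : ℕ} {m : Memory} (h : TableState I S K g i m)
    (hg : ∀ k ≤ K, g k ∈ Set.Icc 0 (I.D I.T)) :
    Runs I rowProg m (rowTime * (K + 1) ^ 2) (TableState I S K g (i + 1)) := by
  refine Runs.mono (Runs.seq (R := RowState I S K g i 0) (Runs.of_loopFree trivial ?_) fun m hm =>
    Runs.seq (Runs.loop (J := RowState I S K g i) (N := K + 1) (c := entryTime * (K + 1))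
      hm ?_ ?_) fun m hm =>
      Runs.of_loopFree (Q := TableState I S K g (i + 1)) ⟨trivial, trivial⟩ ?_) ?_ fun _ => id
  · simp only [setVar_result]
    exact {
      ready := h.ready.writeVar _ (by decide) (by decide) (by decide)
      row := by simp [NExp.eval, Memory.writeNat_nat, h.row]
      point := by simp [NExp.eval, Memory.writeNat_nat]
      base := by simp [NExp.eval, Memory.writeNat_nat, h.base]
      filled := by simpa [Memory.writeNat_nat, Memory.writeNat_real] using h.filled }
  · intro k hk m hm
    refine ⟨?_, entryProg_runs hm hg (Nat.lt_succ_iff.1 hk)⟩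
    rw [whileLt_holds, width_eval hm.ready]
    simp only [var, NExp.eval, hm.point]
    omega
  · intro m hm
    rw [whileLt_holds, width_eval hm.ready]
    simp only [var, NExp.eval, hm.point]
    omega
  · simp only [rowEnd, Prog.result, setVar_result]
    exact {
      ready := (hm.ready.writeVar _ (by decide) (by decide) (by decide)).writeVar _
        (by decide) (by decide) (by decide)
      row := by simp [NExp.eval, var, Memory.writeNat_nat, hm.row]
      base := by
        simp [NExp.eval, var, Memory.writeNat_nat, hm.base, width_eval hm.ready]
        ring
      filled := by
        have e : (i + 1 + 1) * (K + 1) = (i + 1) * (K + 1) + (K + 1) := by ring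
        rw [e]
        simpa [Memory.writeNat_nat, Memory.writeNat_real] using hm.filled }
  · unfold rowTime
    generalize (BExp.not (BExp.leNat width (var 4))).time = t
    generalize (setVar 4 (NExp.lit 0)).cost = a
    generalize rowEnd.cost = b
    generalize entryTime = c
    have h2 : 1 ≤ K + 1 := by omega
    generalize K + 1 = w at *
    have h3 : w ≤ w ^ 2 := Nat.le_self_pow (by decide) w
    have h4 : (w + 1) * (t + c * w + 1) ≤ 2 * (t + c + 1) * w ^ 2 :=
      calc (w + 1) * (t + c * w + 1) ≤ (2 * w) * ((t + c + 1) * w) :=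
            Nat.mul_le_mul (by omega) (by nlinarith [Nat.mul_le_mul_left t h2])
        _ = 2 * (t + c + 1) * w ^ 2 := by ring
    nlinarith [Nat.mul_le_mul_left a (h2.trans h3), Nat.mul_le_mul_left b (h2.trans h3)]

theorem tableProg_runs {m : Memory} (h : TableState I S K g 0 m)
    (hg : ∀ k ≤ K, g k ∈ Set.Icc 0 (I.D I.T)) :
    Runs I tableProg m
      ((S + 1) * ((BExp.not (BExp.leNat (var 0) (var 3))).time + rowTime * (K + 1) ^ 2 + 1))
      (TableState I S K g S) := by
  refine Runs.loop (J := TableState I S K g) h ?_ ?_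
  · intro i hi m hm
    refine ⟨?_, rowProg_runs hm hg⟩
    rw [whileLt_holds]
    simpa only [var, NExp.eval, hm.row, hm.ready.shuttles] using hi
  · intro m hm
    rw [whileLt_holds]
    simp only [var, NExp.eval, hm.row, hm.ready.shuttles]
    omega

/-- The memory after the computation of the departure times and loads of the first `j` shuttles from
the decisions `ch`. -/
structure OutputState (I : Terminal) (S K : ℕ) (g : ℕ → ℝ) (ch : ℕ → ℕ) (j : ℕ) (m : Memory) :
    Prop where
  shuttles : m.nat 0 0 = S
  size : m.nat 0 2 = K
  grid : ∀ k ≤ K, m.real 3 k = g k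
  choice : m.nat 1 = ch
  shuttle : m.nat 0 3 = j
  base : m.nat 0 6 = (S - j) * (K + 1)
  position : m.nat 0 7 = Terminal.path K S ch j
  load : ∀ i ≤ j, m.real 1 i = g (Terminal.path K S ch i)
  departure_zero : m.real 0 0 = 0
  departure : ∀ i < j, m.real 0 (i + 1) = max (m.real 0 i)
    (I.load (g (Terminal.path K S ch i)) (g (Terminal.path K S ch (i + 1))))

theorem shuttleProg_result {ch : ℕ → ℕ} {j : ℕ} {m : Memory} (h : OutputState I S K g ch j m)
    (hg : ∀ k ≤ K, g k ∈ Set.Icc 0 (I.D I.T)) (hp : ∀ j ≤ S, Terminal.path K S ch j ≤ K)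
    (hj : j < S) : shuttleProg.result I m =
      ((((m.writeNat 0 4 (Terminal.path K S ch (j + 1))).writeNat 0 3 (j + 1)).writeReal 1 (j + 1)
        (g (Terminal.path K S ch (j + 1)))).writeReal 0 (j + 1)
        (I.load (g (Terminal.path K S ch j)) (g (Terminal.path K S ch (j + 1))))) := by
  have hn : m.nat 1 ((S - j) * (K + 1) + Terminal.path K S ch j)
      = Terminal.path K S ch (j + 1) := by rw [h.choice]; rfl
  have hg0 := h.grid _ (hp j hj.le)
  have hg1 := h.grid _ (hp (j + 1) hj)
  have hmem := hg _ (hp (j + 1) hj)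
  have hpos := h.position
  have e1 : (NExp.get 1 (NExp.add (var 6) (var 7))).eval m = Terminal.path K S ch (j + 1) := by
    simp only [NExp.eval, var, h.base, h.position, hn]
  generalize Terminal.path K S ch (j + 1) = q at *
  generalize Terminal.path K S ch j = l at *
  have e2 : (NExp.add (var 3) (NExp.lit 1)).eval (m.writeNat 0 4 q) = j + 1 := by
    simp [NExp.eval, var, Memory.writeNat_nat, h.shuttle]
  have e3 : ∀ m : Memory, (var 3).eval (m.writeNat 0 3 (j + 1)) = j + 1 := fun m => by
    simp [NExp.eval, var, Memory.writeNat_nat]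
  have e5 : ∀ (m : Memory) a i x, (var 3).eval (m.writeReal a i x) = (var 3).eval m :=
    fun _ _ _ _ => rfl
  have e4 : (RExp.get 3 (var 4)).eval I ((m.writeNat 0 4 q).writeNat 0 3 (j + 1)) = g q := by
    simp [NExp.eval, RExp.eval, var, Memory.writeNat_nat, Memory.writeNat_real, hg1]
  have e6 : (RExp.get 3 (var 4)).eval I (((m.writeNat 0 4 q).writeNat 0 3 (j + 1)).writeReal 1
      (j + 1) (g q)) = g q := by
    simp [NExp.eval, RExp.eval, var, Memory.writeNat_nat, Memory.writeNat_real,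
      Memory.writeReal_nat, Memory.writeReal_real, hg1]
  have e7 : (RExp.get 3 (var 7)).eval I (((m.writeNat 0 4 q).writeNat 0 3 (j + 1)).writeReal 1
      (j + 1) (g q)) = g l := by
    simp [NExp.eval, RExp.eval, var, Memory.writeNat_nat, Memory.writeNat_real,
      Memory.writeReal_nat, Memory.writeReal_real, hpos, hg0]
  simp only [shuttleProg, Prog.result, setVar_result]
  rw [e1, e2, e5, e3, e4, loadExp_eval (by rwa [e6]), e6, e7]

theorem delayProg_result {j : ℕ} {m : Memory} (h : m.nat 0 3 = j + 1) :
    (delayProg.result I m).nat = m.nat ∧ ∀ a i, (delayProg.result I m).real a i =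
      if a = 0 ∧ i = j + 1 then max (m.real 0 j) (m.real 0 (j + 1)) else m.real a i := by
  have e1 : (var 3).eval m = j + 1 := h
  have e2 : (NExp.sub (var 3) (NExp.lit 1)).eval m = j := by
    simp [NExp.eval, e1]
  have htest : (BExp.leReal (RExp.get 0 (var 3))
      (RExp.get 0 (NExp.sub (var 3) (NExp.lit 1)))).Holds I m ↔ m.real 0 (j + 1) ≤ m.real 0 j := by
    simp only [BExp.Holds, RExp.eval, e1, e2]
  simp only [delayProg, Prog.result, htest, e1, RExp.eval, e2]
  split_ifs with hle
  · refine ⟨rfl, fun a i => ?_⟩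
    rw [Memory.writeReal_real, max_eq_left hle]
    by_cases ha : a = 0
    · subst ha
      simp [Function.update_apply]
    · simp [ha]
  · refine ⟨rfl, fun a i => ?_⟩
    rw [max_eq_right (not_le.1 hle).le]
    split_ifs with hi
    · rw [hi.1, hi.2]
    · rfl

theorem outputBody_runs {ch : ℕ → ℕ} {j : ℕ} {m : Memory} (h : OutputState I S K g ch j m)
    (hg : ∀ k ≤ K, g k ∈ Set.Icc 0 (I.D I.T)) (hp : ∀ j ≤ S, Terminal.path K S ch j ≤ K)
    (hj : j < S) : Runs I outputBody m outputBody.cost (OutputState I S K g ch (j + 1)) := by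
  refine Runs.of_loopFree
    ⟨⟨trivial, trivial, trivial, trivial⟩, ⟨trivial, trivial⟩, trivial, trivial⟩ ?_
  have hb : (S - j) * (K + 1) - (K + 1) = (S - (j + 1)) * (K + 1) := by
    rw [show S - j = S - (j + 1) + 1 by omega, add_mul, one_mul, Nat.add_sub_cancel]
  have hs := shuttleProg_result h hg hp hj
  have hne : ∀ i ≤ j, i ≠ j + 1 := fun i hi => by omega
  generalize hm4 : shuttleProg.result I m = m4 at hs
  obtain ⟨hn, hr⟩ := delayProg_result (I := I) (j := j) (m := m4)
    (by simp [hs, Memory.writeNat_nat, Memory.writeReal_nat])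
  generalize hm5 : delayProg.result I m4 = m5 at hn hr
  simp only [outputBody, Prog.result, setVar_result]
  rw [hm4, hm5]
  have e12 : (var 4).eval m5 = Terminal.path K S ch (j + 1) := by
    simp [NExp.eval, var, hn, hs, Memory.writeNat_nat, Memory.writeReal_nat]
  have e13 : ∀ c, (NExp.sub (var 6) width).eval (m5.writeNat 0 7 c)
      = (S - (j + 1)) * (K + 1) := fun c => by
    rw [← hb]
    simp [NExp.eval, var, width, hn, hs, Memory.writeNat_nat, Memory.writeReal_nat, h.base, h.size]
  rw [e12, e13]
  have hold : ∀ i ≤ j, m5.real 0 i = m.real 0 i := fun i hi => by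
    simp [hr, hs, hne i hi, Memory.writeReal_real, Memory.writeNat_real]
  refine ⟨?_, ?_, ?_, ?_, ?_, ?_, ?_, ?_, ?_, ?_⟩
  · simp [hn, hs, Memory.writeNat_nat, Memory.writeReal_nat, h.shuttles]
  · simp [hn, hs, Memory.writeNat_nat, Memory.writeReal_nat, h.size]
  · intro k hk
    simp [hr, hs, Memory.writeNat_real, Memory.writeReal_real, h.grid k hk]
  · simp [hn, hs, Memory.writeNat_nat, Memory.writeReal_nat, h.choice]
  · simp [hn, hs, Memory.writeNat_nat, Memory.writeReal_nat]
  · simp [Memory.writeNat_nat]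
  · simp [Memory.writeNat_nat]
  · intro i hi
    simp only [Memory.writeNat_real]
    rcases hi.lt_or_eq with hlt | rfl
    · have hi' := Nat.lt_succ_iff.1 hlt
      simp [hr, hs, Memory.writeNat_real, Memory.writeReal_real, hne i hi', h.load i hi']
    · simp [hr, hs, Memory.writeReal_real]
  · rw [Memory.writeNat_real, Memory.writeNat_real, hold 0 (Nat.zero_le j), h.departure_zero]
  · intro i hi
    rw [Memory.writeNat_real, Memory.writeNat_real]
    rcases (Nat.lt_succ_iff.1 hi).lt_or_eq with hlt | rfl
    · rw [hold _ hlt, hold _ hlt.le, h.departure i hlt]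
    · rw [hold _ le_rfl, hr, if_pos ⟨rfl, rfl⟩]
      simp [hs, Memory.writeReal_real, Memory.writeNat_real]

theorem outputProg_runs {m : Memory} (h : TableState I S K g S m)
    (hg : ∀ k ≤ K, g k ∈ Set.Icc 0 (I.D I.T)) (hg0 : g 0 = 0)
    (hp : ∀ j ≤ S, Terminal.path K S (m.nat 1) j ≤ K) :
    Runs I outputProg m
      ((setVar 3 (NExp.lit 0)).cost +
        (S + 1) * ((BExp.not (BExp.leNat (var 0) (var 3))).time + outputBody.cost + 1) + 1)
      (OutputState I S K g (m.nat 1) S) := by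
  refine Runs.seq (R := OutputState I S K g (m.nat 1) 0) (Runs.of_loopFree trivial ?_)
    fun m' hm' => Runs.loop (J := OutputState I S K g (m.nat 1)) hm' ?_ ?_
  · rw [setVar_result]
    refine ⟨?_, ?_, h.ready.grid, ?_, ?_, ?_, ?_, ?_, h.ready.departure, fun i hi => ?_⟩
    · simp [Memory.writeNat_nat, h.ready.shuttles]
    · simp [Memory.writeNat_nat, h.ready.size]
    · simp [Memory.writeNat_nat]
    · simp [Memory.writeNat_nat, NExp.eval]
    · simp [Memory.writeNat_nat, h.base]
    · simp [Memory.writeNat_nat, h.ready.position, Terminal.path]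
    · intro i hi
      obtain rfl : i = 0 := by omega
      rw [Memory.writeNat_real, h.ready.load, Terminal.path, hg0]
    · omega
  · intro j hj m hm
    refine ⟨?_, outputBody_runs hm hg hp hj⟩
    rw [whileLt_holds]
    simpa only [var, NExp.eval, hm.shuttle, hm.shuttles] using hj
  · intro m hm
    rw [whileLt_holds]
    simp only [var, NExp.eval, hm.shuttle, hm.shuttles]
    omega

end

/-- The running time of the algorithm is at most `runTime` times the number of shuttles times the
square of the number of grid points. -/
def runTime : ℕ :=
  meshInit.cost +
    ((BExp.not (BExp.leReal (RExp.demand RExp.constT) (RExp.get 3 (var 2)))).time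
      + gridBody.cost + 1) +
    (Prog.setReal 3 (var 2) (RExp.demand RExp.constT)).cost +
    ((BExp.not (BExp.leNat (var 2) (var 4))).time + penaltyBody.cost + 1) +
    2 * ((BExp.not (BExp.leNat (var 0) (var 3))).time + rowTime + 1) +
    (setVar 3 (NExp.lit 0)).cost +
    2 * ((BExp.not (BExp.leNat (var 0) (var 3))).time + outputBody.cost + 1) + 6

theorem program_runs {I : Terminal}
    (hD : ∀ t ∈ Set.Ico 0 I.T, DifferentiableWithinAt ℝ I.D (Set.Ioi t) t) (hα : 0 < I.slope)
    {S M : ℕ} (hM : 0 < M) (hfeas : ∃ d y : ℕ → ℝ, I.Feasible S d y) :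
    Runs I program (inputMemory S M) (runTime * (S * (I.gridSize (I.C / M) + 1) ^ 2))
      (fun m => I.Feasible S m.outD m.outY ∧ I.avgWait S m.outD m.outY
        ≤ I.optAvg S + (1 / I.slope + 2 * I.ν) * I.C * ((S : ℝ) ^ 2 / (M : ℝ))) := by
  obtain ⟨d, y, h⟩ := id hfeas
  have hC := h.capacity_pos
  have hS : 1 ≤ S := h.pos
  have hη : 0 < I.C / M := div_pos hC (Nat.cast_pos.2 hM)
  have hg : ∀ k ≤ I.gridSize (I.C / M), I.grid (I.C / M) k ∈ Set.Icc 0 (I.D I.T) :=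
    fun k _ => ⟨Terminal.grid_nonneg hη k, Terminal.grid_le _ k⟩
  refine Runs.mono (Runs.seq (gridProg_runs hM hC) fun m ⟨h1, h2, h3, h4, h5, h6, h7⟩ =>
    Runs.seq (penaltyProg_runs h1 h2 h3 h4 h5 h6 h7) fun m ⟨hm, hm3, hm6⟩ =>
    Runs.seq (t₂ := (setVar 3 (NExp.lit 0)).cost +
      (S + 1) * ((BExp.not (BExp.leNat (var 0) (var 3))).time + outputBody.cost + 1) + 1)
      (tableProg_runs ⟨hm, hm3, by rw [hm6, zero_mul], fun i k _ ha => ?_⟩ hg)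
      fun m hm => ?_) ?_ fun _ => id
  · exact absurd ha (by rw [add_mul, add_mul]; omega)
  · have hT : ∀ i < S, ∀ k ≤ I.gridSize (I.C / M), I.Entry (I.gridSize (I.C / M))
        (I.grid (I.C / M)) (m.real 2) (m.nat 1) i k (I.gridSize (I.C / M) + 1) := by
      intro i hi k hk
      refine hm.filled i k hk ?_
      have := Nat.mul_le_mul_right (I.gridSize (I.C / M) + 1) (show i + 2 ≤ S + 1 by omega)
      rw [show i + 2 = i + 1 + 1 from rfl, add_mul (i + 1)] at this
      omega
    refine Runs.mono (outputProg_runs hm hg (Terminal.grid_zero _)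
      fun j hj => Terminal.path_le hT hj) le_rfl fun m' hm' => ?_
    refine Terminal.schedule_of_table hM rfl hD hα hT hm.ready.terminal hm.ready.terminal_last
      hfeas hm'.load hm'.departure_zero fun j hj => ?_
    have := hm'.departure j hj
    rwa [← hm'.load j hj.le, ← hm'.load (j + 1) hj] at this
  · have hW : 1 ≤ I.gridSize (I.C / M) + 1 := by omega
    unfold runTime
    generalize I.gridSize (I.C / M) + 1 = W at *
    generalize meshInit.cost = a
    generalize (BExp.not (BExp.leReal (RExp.demand RExp.constT) (RExp.get 3 (var 2)))).time
      + gridBody.cost + 1 = b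
    generalize (Prog.setReal 3 (var 2) (RExp.demand RExp.constT)).cost = c
    generalize (BExp.not (BExp.leNat (var 2) (var 4))).time + penaltyBody.cost + 1 = e
    generalize (BExp.not (BExp.leNat (var 0) (var 3))).time = t
    generalize rowTime = r
    generalize (setVar 3 (NExp.lit 0)).cost = f
    generalize t + outputBody.cost + 1 = o
    have hWW : W ≤ W ^ 2 := Nat.le_self_pow (by decide) W
    have hSW : W ^ 2 ≤ S * W ^ 2 := Nat.le_mul_of_pos_left _ hS
    have hS2 : S ≤ S * W ^ 2 := Nat.le_mul_of_pos_right _ (hW.trans hWW)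
    have hrow : (S + 1) * (t + r * W ^ 2 + 1) ≤ 2 * (t + r + 1) * (S * W ^ 2) :=
      calc (S + 1) * (t + r * W ^ 2 + 1) ≤ (2 * S) * ((t + r + 1) * W ^ 2) :=
            Nat.mul_le_mul (by omega) (by nlinarith [Nat.mul_le_mul_left t (hW.trans hWW)])
        _ = 2 * (t + r + 1) * (S * W ^ 2) := by ring
    have hout : (S + 1) * o ≤ 2 * o * (S * W ^ 2) := by
      calc (S + 1) * o ≤ (2 * (S * W ^ 2)) * o := Nat.mul_le_mul_right _ (by omega)
        _ = 2 * o * (S * W ^ 2) := by ring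
    have hX : W ≤ S * W ^ 2 := hWW.trans hSW
    generalize S * W ^ 2 = X at *
    have hX1 : 1 ≤ X := hW.trans hX
    have q1 := Nat.mul_le_mul_left a hX1
    have q2 := Nat.mul_le_mul_left b hX
    have q3 := Nat.mul_le_mul_left c hX1
    have q4 := Nat.mul_le_mul_left e hX
    have q5 := Nat.mul_le_mul_left f hX1
    linarith

end Algo

theorem Terminal.gridSize_add_one_le {I : Terminal} {M : ℕ} (hM : 0 < M) (hC : 0 < I.C) :
    ((I.gridSize (I.C / M) + 1 : ℕ) : ℝ) ≤ (I.D I.T / I.C + 2) * M := by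
  have hM1 : (1 : ℝ) ≤ M := Nat.one_le_cast.2 hM
  have hη : 0 < I.C / M := div_pos hC (by linarith)
  have h := (Nat.ceil_lt_add_one (div_nonneg I.D_pos.le hη.le)).le
  have e : I.D I.T / (I.C / M) = I.D I.T / I.C * M := by field_simp
  rw [Terminal.gridSize]
  push_cast
  rw [e] at h ⊢
  linarith

end Shuttle

theorem theorem2 :
    ∃ P : Shuttle.Prog, ∀ I : Shuttle.Terminal,
      (∀ t ∈ Set.Ico 0 I.T, DifferentiableWithinAt ℝ I.D (Set.Ioi t) t) →
      0 < I.slope →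
      ∃ K L : ℝ, ∀ S M : ℕ, 0 < M →
        (∃ d y : ℕ → ℝ, I.Feasible S d y) →
        ∃ (time : ℕ) (m : Shuttle.Memory),
          Shuttle.Exec I P (Shuttle.inputMemory S M) time m ∧
          (time : ℝ) ≤ L * ((S : ℝ) * (M : ℝ) ^ 3) ∧
          I.Feasible S m.outD m.outY ∧
          I.avgWait S m.outD m.outY ≤ I.optAvg S + K * ((S : ℝ) ^ 2 / (M : ℝ)) := by
  refine ⟨Shuttle.Algo.program, fun I hD hα => ⟨(1 / I.slope + 2 * I.ν) * I.C,
    Shuttle.Algo.runTime * (I.D I.T / I.C + 2) ^ 2, fun S M hM hfeas => ?_⟩⟩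
  obtain ⟨time, m, hexec, htime, hfeasible, hopt⟩ :=
    Shuttle.Algo.program_runs hD hα hM hfeas
  refine ⟨time, m, hexec, ?_, hfeasible, hopt⟩
  obtain ⟨d, y, h⟩ := hfeas
  have hW := Shuttle.Terminal.gridSize_add_one_le hM h.capacity_pos
  have hM1 : (1 : ℝ) ≤ M := Nat.one_le_cast.2 hM
  calc (time : ℝ)
      ≤ ((Shuttle.Algo.runTime * (S * (I.gridSize (I.C / M) + 1) ^ 2) : ℕ) : ℝ) :=
        Nat.cast_le.2 htime
    _ = Shuttle.Algo.runTime * (S * ((I.gridSize (I.C / M) + 1 : ℕ) : ℝ) ^ 2) := by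
        push_cast
        rfl
    _ ≤ Shuttle.Algo.runTime * (S * ((I.D I.T / I.C + 2) * M) ^ 2) := by gcongr
    _ = Shuttle.Algo.runTime * (I.D I.T / I.C + 2) ^ 2 * (S * (M : ℝ) ^ 2) := by ring
    _ ≤ Shuttle.Algo.runTime * (I.D I.T / I.C + 2) ^ 2 * (S * (M : ℝ) ^ 3) := by
        have hM2 : (M : ℝ) ^ 2 ≤ (M : ℝ) ^ 3 := pow_le_pow_right₀ hM1 (by decide)
        gcongr
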